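/- Let $0<\alpha<1$ and $h>0$. Consider the collapse of a spherical perfect fluid with equation of state $p=\alpha\,\epsilon$, described near the centre in area-radius coordinates $(r,R)$, $0<R\le r$, by its Misner--Sharp mass $\Psi(r,R)$ and the datum $Y_0(r)$ on the initial surface $\{t=0\}=\{R=r\}$. Put $$R'=-\frac{\alpha}{\alpha+1}\frac{\Psi_{,r}}{\Psi_{,R}},\qquad \rho=\Big(\frac{-\Psi_{,R}}{4\pi\alpha R^2}\Big)^{\frac1{\alpha+1}},\qquad Y(r,R)=\frac{\Psi_{,r}(r,R)}{\Psi_{,r}(r,r)}\Big[\frac{\Psi_{,R}(r,r)R^2}{\Psi_{,R}(r,R)\,r^2}\Big]^{\frac{\alpha}{\alpha+1}}Y_0(r),$$ $$u=\Big(\frac{2\Psi}{R}+Y^2-1\Big)^{1/2},\qquad t(r,R)=\int_R^r\frac{\rho^\alpha(r,\sigma)}{u(r,\sigma)}\,d\sigma,\qquad t_s(r)=t(r,0),$$ so that $t(r,R)$ is the comoving time at which the shell $r$ has area radius $R$, and $t_s$ is the singularity curve. Assume the following standing requirements. The function $Y_0$ is continuous on some $[0,\delta)$, with $Y_0(0)=1$.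 For all sufficiently small $r>0$: $\Psi_{,R}(r,R)<0$ and $\Psi_{,r}(r,R)>0$ for $0<R\le r$; $\Psi_{,R}(r,r)=-\frac{\alpha}{\alpha+1}\Psi_{,r}(r,r)$; $\Psi_{,R}(r,R)/R^2\to-\infty$ as $R\to0^+$; and $\frac{2\Psi}{R}+Y^2-1>0$ for $0<R<r$. Assume moreover that 1. the central singularity forms in a finite amount of comoving time: $\rho^\alpha/u$ is integrable in $\sigma$ on $(0,r)$ for all small $r>0$, and $t_s(r)\to t_0$ as $r\to0^+$ for some $t_0\in(0,\infty)$; 2. $\Psi$ is analytic at $(0,0)$, odd ($\Psi(-r,-R)=-\Psi(r,R)$), and its Taylor expansion is $$\Psi(r,R)=\frac h2\Big(r^3-\frac{\alpha}{\alpha+1}R^3\Big)+\big(\text{terms of total degree }3+k,\ k\ge2\text{ even}\big).$$ (The second-order field equation for $\Psi$ is not needed: the statement holds for every such pair $(\Psi,Y_0)$, in particular for every such solution of the Einstein equations.) Then the central singularity is locally naked. Precisely, there are $b>0$ and an apparent horizon $R_h$ on $(0,b]$, where $R=R_h(r)\in(0,r)$ is the unique solution in $(0,r]$ of $R=2\Psi(r,R)$,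 and there is $R_1>R_h(b)$ such that for every $R_0\in(R_h(b),R_1)$ there is a solution $R_g$ on $(0,b]$, with $R_g(b)=R_0$, of the equation of outgoing radial null geodesics $$\frac{dR}{dr}=-\frac{\alpha}{\alpha+1}\frac{\Psi_{,r}}{\Psi_{,R}}\Big(1-\frac uY\Big)$$ which stays before the apparent horizon, $R_h(r)<R_g(r)<r$ for $0<r\le b$, and extends back to the central singularity: $R_g(r)\to0$ and $t(r,R_g(r))\to t_0$ as $r\to0^+$. -/

import Mathlib

open Filter Topology Set

noncomputable section

namespace PerfectFluid

/-- Partial derivative `Ψ_{,r}` of the mass function in area-radius coordinates `(r, R)`. -/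
def massDr (Ψ : ℝ → ℝ → ℝ) (r R : ℝ) : ℝ := deriv (fun s => Ψ s R) r

/-- Partial derivative `Ψ_{,R}` of the mass function in area-radius coordinates `(r, R)`. -/
def massDR (Ψ : ℝ → ℝ → ℝ) (r R : ℝ) : ℝ := deriv (fun S => Ψ r S) R

/-- The comoving derivative `R' = - α/(α+1) · Ψ_{,r}/Ψ_{,R}`. -/
def radiusPrime (α : ℝ) (Ψ : ℝ → ℝ → ℝ) (r R : ℝ) : ℝ :=
  -(α / (α + 1)) * (massDr Ψ r R / massDR Ψ r R)

/-- The matter density `ρ = (-Ψ_{,R} / (4 π α R²))^(1/(α+1))`. -/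
def density (α : ℝ) (Ψ : ℝ → ℝ → ℝ) (r R : ℝ) : ℝ :=
  (-massDR Ψ r R / (4 * Real.pi * α * R ^ 2)) ^ (1 / (α + 1))

/-- The function `Y`, expressed through the mass function and the datum `Y₀(r) = Y(r,r)`. -/
def effY (α : ℝ) (Ψ : ℝ → ℝ → ℝ) (Y₀ : ℝ → ℝ) (r R : ℝ) : ℝ :=
  massDr Ψ r R / massDr Ψ r r *
    ((massDR Ψ r r * R ^ 2) / (massDR Ψ r R * r ^ 2)) ^ (α / (α + 1)) * Y₀ r

/-- The squared velocity `u² = 2Ψ/R + Y² - 1`. -/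
def velocitySq (α : ℝ) (Ψ : ℝ → ℝ → ℝ) (Y₀ : ℝ → ℝ) (r R : ℝ) : ℝ :=
  2 * Ψ r R / R + effY α Ψ Y₀ r R ^ 2 - 1

/-- The velocity `u = |Ṙ e^{-ν}|`. -/
def velocity (α : ℝ) (Ψ : ℝ → ℝ → ℝ) (Y₀ : ℝ → ℝ) (r R : ℝ) : ℝ :=
  Real.sqrt (velocitySq α Ψ Y₀ r R)

/-- `dt/dR = -ρ^α/u` along a collapsing shell, because `e^ν = ρ^{-α}` and `Ṙ = -u e^ν`;
this is its absolute value. -/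
def timeDensity (α : ℝ) (Ψ : ℝ → ℝ → ℝ) (Y₀ : ℝ → ℝ) (r R : ℝ) : ℝ :=
  density α Ψ r R ^ α / velocity α Ψ Y₀ r R

/-- The comoving time at which the shell `r` has area radius `R`; the shell starts at
`R = r` when `t = 0`. -/
def comovingTime (α : ℝ) (Ψ : ℝ → ℝ → ℝ) (Y₀ : ℝ → ℝ) (r R : ℝ) : ℝ :=
  ∫ σ in R..r, timeDensity α Ψ Y₀ r σ

/-- The singularity curve `t_s(r)`: the comoving time at which `R = 0` on the shell `r`. -/
def singularityTime (α : ℝ) (Ψ : ℝ → ℝ → ℝ) (Y₀ : ℝ → ℝ) (r : ℝ) : ℝ :=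
  comovingTime α Ψ Y₀ r 0

/-- The mass function is analytic at `(0,0)`, odd, and has the Taylor structure
`Ψ = (h/2)(r³ - α/(α+1) R³) + (terms of total degree 3 + k, k ≥ 2 even)`.
By oddness only odd total degrees occur, so the remainder is the part of degree at least 5. -/
structure HasMassExpansion (α h : ℝ) (Ψ : ℝ → ℝ → ℝ) : Prop where
  analytic : AnalyticAt ℝ (Function.uncurry Ψ) (0, 0)
  odd : ∀ᶠ z : ℝ × ℝ in 𝓝 (0, 0), Ψ (-z.1) (-z.2) = -Ψ z.1 z.2
  expansion :
    (fun z : ℝ × ℝ => Ψ z.1 z.2 - h / 2 * (z.1 ^ 3 - α / (α + 1) * z.2 ^ 3))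
      =O[𝓝 (0, 0)] fun z : ℝ × ℝ => ‖z‖ ^ 5

/-- The requirements of physical reasonableness, near the centre. -/
structure IsRegularCollapse (α : ℝ) (Ψ : ℝ → ℝ → ℝ) (Y₀ : ℝ → ℝ) : Prop where
  /-- The datum `Y₀` is continuous near the centre (from the right), and `Y₀(0) = 1`. -/
  Y₀_cont : ∀ᶠ r in 𝓝[≥] (0 : ℝ), ContinuousWithinAt Y₀ (Ici 0) r
  Y₀_zero : Y₀ 0 = 1
  /-- On the initial surface `R = r` one has `R' = 1`. -/
  initial : ∀ᶠ r in 𝓝[>] (0 : ℝ), massDR Ψ r r = -(α / (α + 1)) * massDr Ψ r r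
  /-- Positive pressure. -/
  massDR_neg : ∀ᶠ r in 𝓝[>] (0 : ℝ), ∀ R ∈ Ioc 0 r, massDR Ψ r R < 0
  /-- No shell crossing. -/
  massDr_pos : ∀ᶠ r in 𝓝[>] (0 : ℝ), ∀ R ∈ Ioc 0 r, 0 < massDr Ψ r R
  /-- The density diverges at `R = 0` on each noncentral shell. -/
  shell_focusing : ∀ᶠ r in 𝓝[>] (0 : ℝ),
    Tendsto (fun R => massDR Ψ r R / R ^ 2) (𝓝[>] 0) atBot
  /-- The shells are collapsing: `u` is real and does not vanish between the initial
  surface and the singularity. -/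
  collapsing : ∀ᶠ r in 𝓝[>] (0 : ℝ), ∀ R ∈ Ioo 0 r, 0 < velocitySq α Ψ Y₀ r R

/-- The singularity forms in finite comoving time: `t_s(r)` is finite for the shells near the
centre, and the central singularity forms at the finite time `t₀ = lim_{r → 0⁺} t_s(r) > 0`. -/
structure CentralSingularityAt (α : ℝ) (Ψ : ℝ → ℝ → ℝ) (Y₀ : ℝ → ℝ) (t₀ : ℝ) : Prop where
  finite : ∀ᶠ r in 𝓝[>] (0 : ℝ),
    IntervalIntegrable (timeDensity α Ψ Y₀ r) MeasureTheory.volume 0 r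
  pos : 0 < t₀
  tendsto : Tendsto (singularityTime α Ψ Y₀) (𝓝[>] 0) (𝓝 t₀)

/-- The right-hand side `R' (1 - u/Y)` of the equation of outgoing radial null geodesics. -/
def nullSlope (α : ℝ) (Ψ : ℝ → ℝ → ℝ) (Y₀ : ℝ → ℝ) (r R : ℝ) : ℝ :=
  radiusPrime α Ψ r R * (1 - velocity α Ψ Y₀ r R / effY α Ψ Y₀ r R)

/-- `R_h` is the apparent horizon on `(0, b]`: `R = R_h(r)` is the unique solution of
`R = 2Ψ(r,R)` in `(0, r]`, and it lies in `(0, r)`. -/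
def IsApparentHorizon (Ψ : ℝ → ℝ → ℝ) (b : ℝ) (Rh : ℝ → ℝ) : Prop :=
  ∀ r ∈ Ioc 0 b, Rh r ∈ Ioo 0 r ∧ ∀ R ∈ Ioc 0 r, R = 2 * Ψ r R ↔ R = Rh r

/-- `R_g` is an outgoing radial null geodesic on `(0, b]` that stays before the apparent
horizon `R_h` and extends back to the central singularity: as `r → 0⁺`, its area radius
tends to `0` and its comoving time to `t₀`. -/
structure EmanatesFromCentralSingularity (α : ℝ) (Ψ : ℝ → ℝ → ℝ) (Y₀ : ℝ → ℝ) (t₀ : ℝ)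
    (b : ℝ) (Rh Rg : ℝ → ℝ) : Prop where
  before_horizon : ∀ r ∈ Ioc 0 b, Rh r < Rg r ∧ Rg r < r
  geodesic : ∀ r ∈ Ioc 0 b,
    HasDerivWithinAt Rg (nullSlope α Ψ Y₀ r (Rg r)) (Ioc 0 b) r
  radius_tendsto : Tendsto Rg (𝓝[>] 0) (𝓝 0)
  time_tendsto : Tendsto (fun r => comovingTime α Ψ Y₀ r (Rg r)) (𝓝[>] 0) (𝓝 t₀)

end PerfectFluid

end

/-! Write β = α/(α+1); since α < 1, 2β < 1, and this exponent drives every estimate. In the region R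
≤ r² the Taylor expansion gives 2Ψ = h r³ + O(r⁵), so the horizon is trapped between the barriers h
r³ ± M r⁵. The other unknown is w = R²/(-Ψ_{,R}), in terms of which Y ~ w^β and ρ^α ~ w^{-β}. Only a
lower bound on w is needed: w ≥ R²/(D r⁴), hence w ≳ r² when R ~ r³. A geodesic is followed
backwards from r = b. On the upper barrier R - 2Ψ ≥ r⁵, so 1 - u/Y ≳ r²/Y² while R' ~ w/r⁴; the null
slope is ≳ w^{1-2β}/r², hence bounded below, whereas the barrier has slope O(r²). So a geodesic
starting below the barrier stays below it (`exists_barrierBounds`, `pos_of_deriv_neg_at_zeros`). At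
the horizon the slope vanishes, and R - 2Ψ has derivative -2Ψ_{,r} < 0 along the geodesic, so it
never meets the horizon as r decreases. Finally t(r,R_g) = t_s(r) - ∫₀^{R_g} ρ^α/u. The integrand is
at most K σ^{-2β} with K independent of r, which is integrable at 0, so the correction vanishes as
R_g → 0 (`tendsto_integral_timeDensity`). -/

open scoped ENNReal NNReal

/-! ### Differentiating an order-of-vanishing estimate -/

/-- The formal multilinear series `p` with its terms of degree less than `n` removed. -/
def FormalMultilinearSeries.dropBelow {E F : Type*} [NormedAddCommGroup E] [NormedSpace ℝ E]
    [NormedAddCommGroup F] [NormedSpace ℝ F] (p : FormalMultilinearSeries ℝ E F) (n : ℕ) :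
    FormalMultilinearSeries ℝ E F :=
  fun k => if k < n then 0 else p k

/-- The coefficients `p k` need not be symmetric, so vanishing on the diagonal does not make them
zero. Replacing them by zero leaves the sum unchanged and makes the low terms of the derived series
vanish as well. -/
theorem HasFPowerSeriesOnBall.dropBelow {E F : Type*} [NormedAddCommGroup E] [NormedSpace ℝ E]
    [NormedAddCommGroup F] [NormedSpace ℝ F] {f : E → F} {p : FormalMultilinearSeries ℝ E F}
    {x : E} {r : ℝ≥0∞} (hf : HasFPowerSeriesOnBall f p x r) (n : ℕ)
    (hp : ∀ k < n, ∀ y : E, p k (fun _ => y) = 0) :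
    HasFPowerSeriesOnBall f (p.dropBelow n) x r := by
  refine ⟨hf.r_le.trans (FormalMultilinearSeries.radius_le_of_le fun k => ?_), hf.r_pos,
    fun {y} hy => ?_⟩
  · unfold FormalMultilinearSeries.dropBelow
    split_ifs <;> simp
  · convert hf.hasSum hy using 2 with k
    unfold FormalMultilinearSeries.dropBelow
    split_ifs with hk
    · rw [hp k hk y]; rfl
    · rfl

/-- For analytic f the order of vanishing is visible in the power series, so the series can be
differentiated term by term; for merely smooth bounds no such implication holds. -/
theorem fderiv_isBigO_of_isBigO_norm_pow {E F : Type*} [NormedAddCommGroup E] [NormedSpace ℝ E]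
    [NormedAddCommGroup F] [NormedSpace ℝ F] [CompleteSpace F] {f : E → F} (n : ℕ)
    (hf : AnalyticAt ℝ f 0) (h : f =O[𝓝 0] fun z => ‖z‖ ^ (n + 1)) :
    fderiv ℝ f =O[𝓝 0] fun z => ‖z‖ ^ n := by
  obtain ⟨p, r, hr⟩ := hf
  have hp : ∀ k, k < n + 1 → ∀ y : E, p k (fun _ => y) = 0 := by
    intro k
    induction k using Nat.strong_induction_on with
    | _ k ih =>
      intro hk
      have psum_eq : p.partialSum (k + 1) = fun y => p k fun _ => y := by
        funext z
        refine Finset.sum_eq_single _ (fun b hb hnb => ?_) fun hn => ?_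
        · have := Finset.mem_range_succ_iff.mp hb
          exact ih b (this.lt_of_ne hnb) (by omega) z
        · exact False.elim (hn (Finset.mem_range.mpr (lt_add_one k)))
      have h1 := hr.hasFPowerSeriesAt.isBigO_sub_partialSum_pow (k + 1)
      simp only [psum_eq, zero_add] at h1
      -- Both f and f minus its degree-k term are O(‖z‖^(k+1)); a homogeneous term of degree k with
      -- that bound is zero.
      have h2 : f =O[𝓝 0] fun z => ‖z‖ ^ (k + 1) := by
        refine h.trans (Asymptotics.IsBigO.of_bound 1 ?_)
        filter_upwards [Metric.ball_mem_nhds (0 : E) one_pos] with z hz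
        simp only [norm_pow, norm_norm, one_mul]
        exact pow_le_pow_of_le_one (norm_nonneg _) (by simpa using (mem_ball_zero_iff.mp hz).le)
          (by omega)
      have h3 := h2.sub h1
      simp only [sub_sub_cancel] at h3
      exact h3.continuousMultilinearMap_apply_eq_zero
  have hq := (hr.dropBelow (n + 1) hp).fderiv
  have h1 := hq.hasFPowerSeriesAt.isBigO_sub_partialSum_pow n
  refine h1.congr_left fun y => ?_
  rw [FormalMultilinearSeries.partialSum, Finset.sum_eq_zero, sub_zero, zero_add]
  intro k hk
  rw [FormalMultilinearSeries.derivSeries_eq_zero]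
  · rfl
  -- The degree-k term of the derivative comes from degree k + 1 of f, so k < n reaches exactly the
  -- dropped range.
  · exact if_pos (by simpa using hk)

/-! ### Backward ODE solutions and a comparison principle -/

theorem exists_hasDerivWithinAt_Icc_of_lipschitz {F : ℝ → ℝ → ℝ} {a b : ℝ} (hab : a ≤ b)
    {K B : ℝ≥0} (hlip : ∀ t ∈ Icc a b, LipschitzWith K (F t))
    (hcont : ∀ x, ContinuousOn (F · x) (Icc a b)) (hB : ∀ t ∈ Icc a b, ∀ x, ‖F t x‖ ≤ B)
    (x₀ : ℝ) :
    ∃ R : ℝ → ℝ, R b = x₀ ∧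
      ∀ t ∈ Icc a b, HasDerivWithinAt R (F t (R t)) (Icc a b) t := by
  have h : IsPicardLindelof F (⟨b, right_mem_Icc.mpr hab⟩ : Icc a b) x₀
      (B * (b - a).toNNReal) 0 B K :=
    { lipschitzOnWith := fun t ht => (hlip t ht).lipschitzOnWith
      continuousOn := fun x _ => hcont x
      norm_le := fun t ht x _ => hB t ht x
      mul_max_le := by
        simp only [sub_self, NNReal.coe_mul, NNReal.coe_zero, sub_zero]
        rw [max_eq_right (sub_nonneg.mpr hab), Real.coe_toNNReal _ (sub_nonneg.mpr hab)] }
  exact h.exists_eq_forall_mem_Icc_hasDerivWithinAt₀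

/-- The constants may blow up as a → 0: solutions on the intervals [a, b] share the datum at b,
agree by uniqueness, and glue. -/
theorem exists_hasDerivWithinAt_Ioc_of_lipschitz {F : ℝ → ℝ → ℝ} {b : ℝ} (hb : 0 < b)
    (hF : ∀ a ∈ Ioo 0 b, ∃ K B : ℝ≥0, (∀ t ∈ Icc a b, LipschitzWith K (F t)) ∧
      (∀ x, ContinuousOn (F · x) (Icc a b)) ∧ ∀ t ∈ Icc a b, ∀ x, ‖F t x‖ ≤ B)
    (x₀ : ℝ) :
    ∃ R : ℝ → ℝ, R b = x₀ ∧
      ∀ t ∈ Ioc 0 b, HasDerivWithinAt R (F t (R t)) (Ioc 0 b) t := by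
  have hex : ∀ a, ∃ R : ℝ → ℝ, a ∈ Ioo 0 b → R b = x₀ ∧
      ∀ t ∈ Icc a b, HasDerivWithinAt R (F t (R t)) (Icc a b) t := by
    intro a
    by_cases ha : a ∈ Ioo 0 b
    · obtain ⟨K, B, h1, h2, h3⟩ := hF a ha
      obtain ⟨R, hR⟩ := exists_hasDerivWithinAt_Icc_of_lipschitz ha.2.le h1 h2 h3 x₀
      exact ⟨R, fun _ => hR⟩
    · exact ⟨0, fun h => absurd h ha⟩
  choose sol hsol using hex
  have key : ∀ a ∈ Ioo 0 b, ∀ a' ∈ Ioo 0 b, a ≤ a' → EqOn (sol a) (sol a') (Icc a' b) := by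
    intro a ha a' ha' haa
    obtain ⟨K, B, h1, -, -⟩ := hF a' ha'
    obtain ⟨e1, d1⟩ := hsol a ha
    obtain ⟨e2, d2⟩ := hsol a' ha'
    have hIic : ∀ t ∈ Ioc a' b, Icc a' b ∈ 𝓝[Iic t] t := fun t ht =>
      mem_of_superset (Icc_mem_nhdsLE ht.1) (Icc_subset_Icc_right ht.2)
    have d1' : ∀ t ∈ Icc a' b, HasDerivWithinAt (sol a) (F t (sol a t)) (Icc a' b) t :=
      fun t ht => (d1 t ⟨haa.trans ht.1, ht.2⟩).mono (Icc_subset_Icc_left haa)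
    exact ODE_solution_unique_of_mem_Icc_left (v := F) (s := fun _ => univ) (K := K)
      (fun t ht => (h1 t ⟨ht.1.le, ht.2⟩).lipschitzOnWith)
      (fun t ht => (d1' t ht).continuousWithinAt)
      (fun t ht => (d1' t ⟨ht.1.le, ht.2⟩).mono_of_mem_nhdsWithin (hIic t ht))
      (fun _ _ => mem_univ _)
      (fun t ht => (d2 t ht).continuousWithinAt)
      (fun t ht => (d2 t ⟨ht.1.le, ht.2⟩).mono_of_mem_nhdsWithin (hIic t ht))
      (fun _ _ => mem_univ _) (e1.trans e2.symm)
  have half : ∀ t ∈ Ioc 0 b, t / 2 ∈ Ioo 0 b := fun t ht => ⟨by linarith [ht.1], by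
    linarith [ht.1, ht.2]⟩
  -- The value at t is read off the solution on [t/2, b]; for s > t/2 it agrees with the single
  -- solution on [t/4, b], which gives the derivative at t.
  refine ⟨fun t => sol (t / 2) t, (hsol _ (half b ⟨hb, le_rfl⟩)).1, fun t ht => ?_⟩
  have hq : t / 4 ∈ Ioo 0 b := ⟨by linarith [ht.1], by linarith [ht.1, ht.2]⟩
  have heq : ∀ s ∈ Ioc (t / 2) b, sol (s / 2) s = sol (t / 4) s := fun s hs =>
    (key _ hq (s / 2) (half s ⟨by linarith [hs.1, ht.1], hs.2⟩) (by linarith [hs.1])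
      ⟨by linarith [hs.1, ht.1], hs.2⟩).symm
  have htm : t ∈ Ioc (t / 2) b := ⟨by linarith [ht.1], ht.2⟩
  have hmem : ∀ c < t, Ioc c b ∈ 𝓝[Ioc 0 b] t := fun c hc =>
    mem_of_superset (inter_mem_nhdsWithin _ (Ioi_mem_nhds hc)) fun s hs => ⟨hs.2, hs.1.2⟩
  have hd := (hsol _ hq).2 t ⟨by linarith [ht.1], ht.2⟩
  have hd' : HasDerivWithinAt (sol (t / 4)) (F t (sol (t / 4) t)) (Ioc 0 b) t :=
    hd.mono_of_mem_nhdsWithin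
      (mem_of_superset (hmem (t / 4) (by linarith [ht.1])) Ioc_subset_Icc_self)
  have hd2 := hd'.congr_of_eventuallyEq (f₁ := fun s => sol (s / 2) s)
    (mem_of_superset (hmem (t / 2) htm.1) heq) (heq t htm)
  simpa only [heq t htm] using hd2

/-- A function on `(0, b]` that is positive at `b` and has negative derivative at each of its zeros
in `(0, b)` is positive. -/
theorem pos_of_deriv_neg_at_zeros {φ : ℝ → ℝ} {b : ℝ} (hc : ContinuousOn φ (Ioc 0 b))
    (hb : 0 < φ b) (hz : ∀ r ∈ Ioo 0 b, φ r = 0 → ∃ d < 0, HasDerivAt φ d r) :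
    ∀ r ∈ Ioc 0 b, 0 < φ r := by
  intro r hr
  by_contra! hneg
  have hrb : r ≤ b := hr.2
  have hcc : ContinuousOn φ (Icc r b) := hc.mono fun s hs => ⟨hr.1.trans_le hs.1, hs.2⟩
  set Z := Icc r b ∩ φ ⁻¹' {0} with hZ
  have hZc : IsCompact Z :=
    isCompact_Icc.of_isClosed_subset (hcc.preimage_isClosed_of_isClosed isClosed_Icc
      isClosed_singleton) inter_subset_left
  have hZn : Z.Nonempty := by
    obtain ⟨s, hs, hs0⟩ := intermediate_value_Icc hrb hcc ⟨hneg, hb.le⟩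
    exact ⟨s, hs, hs0⟩
  obtain ⟨s, ⟨hs, hs0⟩, hmax⟩ := hZc.exists_isGreatest hZn
  have hs0 : φ s = 0 := hs0
  have hsb : s < b := lt_of_le_of_ne hs.2 fun h => by rw [h] at hs0; exact hb.ne' hs0
  obtain ⟨d, hd, hder⟩ := hz s ⟨hr.1.trans_le hs.1, hsb⟩ hs0
  -- s is the largest zero in [r, b]. A negative derivative there makes φ negative just to the
  -- right, forcing a later zero before b.
  have hev : ∀ᶠ x in 𝓝[>] s, φ x < 0 := by
    have := (hasDerivAt_iff_tendsto_slope.mp hder).eventually_lt_const hd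
    have h2 : ∀ᶠ x in 𝓝[>] s, slope φ s x < 0 :=
      this.filter_mono (nhdsWithin_mono _ fun x hx => ne_of_gt hx)
    filter_upwards [h2, self_mem_nhdsWithin] with x hx hxs
    rw [slope_def_field, hs0, sub_zero] at hx
    by_contra! h
    exact absurd hx (not_lt.mpr (div_nonneg h (sub_nonneg.mpr (le_of_lt hxs))))
  obtain ⟨x, hx, hxI⟩ := (hev.and (Ioo_mem_nhdsGT hsb)).exists
  obtain ⟨y, hy, hy0⟩ := intermediate_value_Icc hxI.2.le
    (hcc.mono (Icc_subset_Icc_left (hs.1.trans hxI.1.le))) ⟨hx.le, hb.le⟩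
  have := hmax (show y ∈ Z from ⟨⟨hs.1.trans (hxI.1.le.trans hy.1), hy.2⟩, hy0⟩)
  linarith [hxI.1, hy.1]

/-! ### Taylor estimates for the mass function and its derivatives -/

namespace PerfectFluid

section MassFunction

variable {α h : ℝ} {Ψ : ℝ → ℝ → ℝ}

theorem hasDerivAt_massDr {z : ℝ × ℝ} (hz : DifferentiableAt ℝ (Function.uncurry Ψ) z) :
    HasDerivAt (fun s => Ψ s z.2) (fderiv ℝ (Function.uncurry Ψ) z (1, 0)) z.1 :=
  HasFDerivAt.comp_hasDerivAt (f := fun s => (s, z.2)) z.1 hz.hasFDerivAt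
    ((hasDerivAt_id z.1).prodMk (hasDerivAt_const z.1 z.2))

theorem hasDerivAt_massDR {z : ℝ × ℝ} (hz : DifferentiableAt ℝ (Function.uncurry Ψ) z) :
    HasDerivAt (fun S => Ψ z.1 S) (fderiv ℝ (Function.uncurry Ψ) z (0, 1)) z.2 :=
  HasFDerivAt.comp_hasDerivAt (f := fun S => (z.1, S)) z.2 hz.hasFDerivAt
    ((hasDerivAt_const z.2 z.1).prodMk (hasDerivAt_id z.2))

theorem massDr_eq_fderiv {r R : ℝ} (hz : DifferentiableAt ℝ (Function.uncurry Ψ) (r, R)) :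
    massDr Ψ r R = fderiv ℝ (Function.uncurry Ψ) (r, R) (1, 0) :=
  (hasDerivAt_massDr hz).deriv

theorem massDR_eq_fderiv {r R : ℝ} (hz : DifferentiableAt ℝ (Function.uncurry Ψ) (r, R)) :
    massDR Ψ r R = fderiv ℝ (Function.uncurry Ψ) (r, R) (0, 1) :=
  (hasDerivAt_massDR hz).deriv

theorem eventually_massDr_eq {z : ℝ × ℝ} (hz : AnalyticAt ℝ (Function.uncurry Ψ) z) :
    Function.uncurry (massDr Ψ) =ᶠ[𝓝 z] fun w => fderiv ℝ (Function.uncurry Ψ) w (1, 0) := by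
  filter_upwards [hz.eventually_analyticAt] with w hw
  exact massDr_eq_fderiv hw.differentiableAt

theorem eventually_massDR_eq {z : ℝ × ℝ} (hz : AnalyticAt ℝ (Function.uncurry Ψ) z) :
    Function.uncurry (massDR Ψ) =ᶠ[𝓝 z] fun w => fderiv ℝ (Function.uncurry Ψ) w (0, 1) := by
  filter_upwards [hz.eventually_analyticAt] with w hw
  exact massDR_eq_fderiv hw.differentiableAt

theorem contDiffAt_massDr {z : ℝ × ℝ} (hz : AnalyticAt ℝ (Function.uncurry Ψ) z) :
    ContDiffAt ℝ 1 (Function.uncurry (massDr Ψ)) z :=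
  (hz.fderiv.contDiffAt.clm_apply contDiffAt_const).congr_of_eventuallyEq (eventually_massDr_eq hz)

theorem contDiffAt_massDR {z : ℝ × ℝ} (hz : AnalyticAt ℝ (Function.uncurry Ψ) z) :
    ContDiffAt ℝ 1 (Function.uncurry (massDR Ψ)) z :=
  (hz.fderiv.contDiffAt.clm_apply contDiffAt_const).congr_of_eventuallyEq (eventually_massDR_eq hz)

/-- The mass function and its first derivatives agree near the centre, up to relative order two,
with those of the leading cubic part. -/
theorem HasMassExpansion.exists_bounds (hΨ : HasMassExpansion α h Ψ) :
    ∃ C > 0, ∃ δ > 0, ∀ r R : ℝ, 0 < r → r < δ → 0 ≤ R → R ≤ r →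
      AnalyticAt ℝ (Function.uncurry Ψ) (r, R) ∧
      |2 * Ψ r R - h * (r ^ 3 - α / (α + 1) * R ^ 3)| ≤ C * r ^ 5 ∧
      |massDr Ψ r R - 3 / 2 * h * r ^ 2| ≤ C * r ^ 4 ∧
      |massDR Ψ r R + 3 / 2 * h * (α / (α + 1)) * R ^ 2| ≤ C * r ^ 4 := by
  set β := α / (α + 1) with hβ
  set g : ℝ × ℝ → ℝ := fun z => Ψ z.1 z.2 - h / 2 * (z.1 ^ 3 - β * z.2 ^ 3) with hg
  have hga : AnalyticAt ℝ g (0, 0) := by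
    have h1 : AnalyticAt ℝ (fun z : ℝ × ℝ => Ψ z.1 z.2) (0, 0) := hΨ.analytic
    have h2 : AnalyticAt ℝ (fun z : ℝ × ℝ => z.1) (0, 0) := analyticAt_fst
    have h3 : AnalyticAt ℝ (fun z : ℝ × ℝ => z.2) (0, 0) := analyticAt_snd
    exact h1.sub (analyticAt_const.mul ((h2.pow 3).sub (analyticAt_const.mul (h3.pow 3))))
  have hgO : g =O[𝓝 0] fun z => ‖z‖ ^ (4 + 1) := hΨ.expansion
  have hdO := fderiv_isBigO_of_isBigO_norm_pow 4 hga hgO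
  obtain ⟨C₁, hC₁, h1⟩ := hgO.exists_pos
  obtain ⟨C₂, hC₂, h2⟩ := hdO.exists_pos
  rw [Asymptotics.isBigOWith_iff] at h1 h2
  have hall := (h1.and h2).and (hga.eventually_analyticAt.and hΨ.analytic.eventually_analyticAt)
  obtain ⟨δ, hδ, hball⟩ := Metric.eventually_nhds_iff.mp hall
  refine ⟨2 * C₁ + C₂, by positivity, δ, hδ, fun r R hr hrδ hR hRr => ?_⟩
  have hnorm : ‖(r, R)‖ = r := by
    rw [Prod.norm_def, Real.norm_of_nonneg hr.le, Real.norm_of_nonneg hR, max_eq_left hRr]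
  obtain ⟨⟨k1, k2⟩, k3, k4⟩ := @hball (r, R) (by
    rw [dist_zero_right, hnorm]; exact hrδ)
  rw [hnorm, Real.norm_of_nonneg (pow_nonneg hr.le _)] at k1 k2
  have k4d := k4.differentiableAt
  have hr4 : 0 ≤ r ^ 4 := by positivity
  have hr5 : 0 ≤ r ^ 5 := by positivity
  have hop : ∀ v : ℝ × ℝ, ‖v‖ ≤ 1 → |fderiv ℝ g (r, R) v| ≤ C₂ * r ^ 4 := fun v hv =>
    ((fderiv ℝ g (r, R)).le_opNorm v).trans
      ((mul_le_of_le_one_right (norm_nonneg _) hv).trans k2)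
  refine ⟨k4, ?_, ?_, ?_⟩
  · have e : 2 * Ψ r R - h * (r ^ 3 - β * R ^ 3) = 2 * g (r, R) := by simp only [hg]; ring
    rw [e, abs_mul, abs_two]
    calc 2 * |g (r, R)| ≤ 2 * (C₁ * r ^ 5) := mul_le_mul_of_nonneg_left k1 zero_le_two
      _ ≤ (2 * C₁ + C₂) * r ^ 5 := by nlinarith [mul_nonneg hC₂.le hr5]
  · have d1 := hasDerivAt_massDr (Ψ := fun s S => g (s, S)) (z := (r, R)) k3.differentiableAt
    have d2 : HasDerivAt (fun s => h / 2 * (s ^ 3 - β * R ^ 3)) (h / 2 * (3 * r ^ 2)) r := by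
      simpa using ((hasDerivAt_pow 3 r).sub_const (β * R ^ 3)).const_mul (h / 2)
    have d3 := (d1.add d2).deriv
    have e : massDr Ψ r R = fderiv ℝ g (r, R) (1, 0) + h / 2 * (3 * r ^ 2) := by
      rw [massDr, ← show _ = fderiv ℝ g (r, R) (1, 0) + h / 2 * (3 * r ^ 2) from d3]
      congr 1
      funext s
      simp [hg]
    rw [e, show ∀ x : ℝ, x + h / 2 * (3 * r ^ 2) - 3 / 2 * h * r ^ 2 = x from fun x => by ring]
    refine (hop _ (by simp [Prod.norm_def])).trans ?_
    nlinarith [mul_nonneg hC₁.le hr4]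
  · have d1 := hasDerivAt_massDR (Ψ := fun s S => g (s, S)) (z := (r, R)) k3.differentiableAt
    have d2 : HasDerivAt (fun S => h / 2 * (r ^ 3 - β * S ^ 3)) (h / 2 * (-(β * (3 * R ^ 2)))) R := by
      simpa using (((hasDerivAt_pow 3 R).const_mul β).const_sub (r ^ 3)).const_mul (h / 2)
    have d3 := (d1.add d2).deriv
    have e : massDR Ψ r R = fderiv ℝ g (r, R) (0, 1) + h / 2 * (-(β * (3 * R ^ 2))) := by
      rw [massDR, ← show _ = fderiv ℝ g (r, R) (0, 1) + h / 2 * (-(β * (3 * R ^ 2))) from d3]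
      congr 1
      funext s
      simp [hg]
    rw [e, show ∀ x : ℝ, x + h / 2 * (-(β * (3 * R ^ 2))) + 3 / 2 * h * β * R ^ 2 = x
      from fun x => by ring]
    refine (hop _ (by simp [Prod.norm_def])).trans ?_
    nlinarith [mul_nonneg hC₁.le hr4]

end MassFunction

/-! ### Uniform bounds on a shell, and Y and ρ in terms of w -/

/-- Bounds satisfied on every shell `r` close enough to the centre. -/
structure ShellBounds (α h C : ℝ) (Ψ : ℝ → ℝ → ℝ) (Y₀ : ℝ → ℝ) (r : ℝ) : Prop where
  pos : 0 < r
  analytic : ∀ R ∈ Icc 0 r, AnalyticAt ℝ (Function.uncurry Ψ) (r, R)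
  mass : ∀ R ∈ Icc 0 r, |2 * Ψ r R - h * (r ^ 3 - α / (α + 1) * R ^ 3)| ≤ C * r ^ 5
  le_massDr : ∀ R ∈ Icc 0 r, h * r ^ 2 ≤ massDr Ψ r R
  massDr_le : ∀ R ∈ Icc 0 r, massDr Ψ r R ≤ 2 * h * r ^ 2
  massDR_neg : ∀ R ∈ Ioc 0 r, massDR Ψ r R < 0
  neg_massDR_le : ∀ R ∈ Icc 0 r,
    -massDR Ψ r R ≤ 3 / 2 * h * (α / (α + 1)) * R ^ 2 + C * r ^ 4
  initial : massDR Ψ r r = -(α / (α + 1)) * massDr Ψ r r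
  datum : Y₀ r ∈ Ioo (1 / 2) 2
  datum_cont : ContinuousAt Y₀ r

theorem exists_shellBounds {α h : ℝ} {Ψ : ℝ → ℝ → ℝ} {Y₀ : ℝ → ℝ} (hh : 0 < h)
    (hreg : IsRegularCollapse α Ψ Y₀) (hΨ : HasMassExpansion α h Ψ) :
    ∃ C > 0, ∀ᶠ r in 𝓝[>] (0 : ℝ), ShellBounds α h C Ψ Y₀ r := by
  obtain ⟨C, hC, δ, hδ, H⟩ := hΨ.exists_bounds
  refine ⟨C, hC, ?_⟩
  -- Makes the error C r⁴ at most a third of 3/2 h r², so that Ψ_{,r} lies between h r² and 2h r².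
  have hsmall : ∀ᶠ r in 𝓝[>] (0 : ℝ), C * r ^ 2 < h / 2 := by
    have : Tendsto (fun r : ℝ => C * r ^ 2) (𝓝 0) (𝓝 (C * 0 ^ 2)) :=
      (Continuous.tendsto (by fun_prop) 0)
    exact (this.mono_left nhdsWithin_le_nhds).eventually_lt_const (by simpa using hh)
  have hY : ContinuousWithinAt Y₀ (Ici 0) 0 := hreg.Y₀_cont.self_of_nhdsWithin (le_refl (0 : ℝ))
  have hY2 : ∀ᶠ r in 𝓝[>] (0 : ℝ), Y₀ r ∈ Ioo (1 / 2 : ℝ) 2 := by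
    have h1 : Tendsto Y₀ (𝓝[>] 0) (𝓝 1) := by
      rw [← hreg.Y₀_zero]
      exact hY.mono_left (nhdsWithin_mono _ Ioi_subset_Ici_self)
    exact h1.eventually (Ioo_mem_nhds (by norm_num) (by norm_num))
  have hYc := hreg.Y₀_cont.filter_mono (nhdsWithin_mono (0 : ℝ) Ioi_subset_Ici_self)
  filter_upwards [hsmall, hY2, hYc, hreg.initial, hreg.massDR_neg, self_mem_nhdsWithin,
    Ioo_mem_nhdsGT hδ] with r h1 h2 h3 h4 h5 (h6 : 0 < r) h7
  have hr4 : C * r ^ 4 ≤ h / 2 * r ^ 2 := by nlinarith [sq_nonneg r]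
  refine ⟨h6, fun R hR => (H r R h6 h7.2 hR.1 hR.2).1, fun R hR => (H r R h6 h7.2 hR.1 hR.2).2.1,
    fun R hR => ?_, fun R hR => ?_, h5, fun R hR => ?_, h4, h2,
    h3.continuousAt (Ici_mem_nhds h6)⟩
  · have := abs_le.mp (H r R h6 h7.2 hR.1 hR.2).2.2.1
    linarith [this.1]
  · have := abs_le.mp (H r R h6 h7.2 hR.1 hR.2).2.2.1
    linarith [this.2]
  · have := abs_le.mp (H r R h6 h7.2 hR.1 hR.2).2.2.2
    linarith [this.1]

/-- The ratio `R² / (-Ψ_{,R})`, which is proportional to a negative power of the density. -/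
noncomputable def rarity (Ψ : ℝ → ℝ → ℝ) (r R : ℝ) : ℝ := R ^ 2 / -massDR Ψ r R

namespace ShellBounds

variable {α h C : ℝ} {Ψ : ℝ → ℝ → ℝ} {Y₀ : ℝ → ℝ} {r R : ℝ}

theorem rarity_pos (B : ShellBounds α h C Ψ Y₀ r) (hR : R ∈ Ioc 0 r) : 0 < rarity Ψ r R :=
  div_pos (pow_pos hR.1 2) (neg_pos.mpr (B.massDR_neg R hR))

/-- The initial condition trades Ψ_{,R}(r,r) for Ψ_{,r}(r,r), of size r², so the only uncontrolled
factor left in Y is w^β. -/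
theorem effY_eq (B : ShellBounds α h C Ψ Y₀ r) :
    effY α Ψ Y₀ r R = massDr Ψ r R / massDr Ψ r r *
      (α / (α + 1) * (massDr Ψ r r / r ^ 2) * rarity Ψ r R) ^ (α / (α + 1)) * Y₀ r := by
  unfold effY rarity
  congr 3
  rw [B.initial, div_neg, mul_neg, mul_comm (massDR Ψ r R), mul_div_mul_comm]
  ring

theorem effY_bounds (B : ShellBounds α h C Ψ Y₀ r) (hα : 0 < α) (hh : 0 < h) (hR : R ∈ Ioc 0 r) :
    1 / 4 * (α / (α + 1) * h) ^ (α / (α + 1)) * rarity Ψ r R ^ (α / (α + 1)) ≤ effY α Ψ Y₀ r R ∧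
    effY α Ψ Y₀ r R ≤
      4 * (α / (α + 1) * (2 * h)) ^ (α / (α + 1)) * rarity Ψ r R ^ (α / (α + 1)) := by
  have hw := B.rarity_pos hR
  have hr2 : 0 < r ^ 2 := pow_pos B.pos 2
  have hβ : 0 < α / (α + 1) := by positivity
  rw [B.effY_eq]
  set β := α / (α + 1)
  set w := rarity Ψ r R
  have hRI : R ∈ Icc 0 r := ⟨hR.1.le, hR.2⟩
  have hrI : r ∈ Icc 0 r := ⟨B.pos.le, le_rfl⟩
  have a1 := B.le_massDr R hRI
  have a2 := B.massDr_le R hRI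
  have b1 := B.le_massDr r hrI
  have b2 := B.massDr_le r hrI
  have hpos : 0 < massDr Ψ r r := (by positivity : 0 < h * r ^ 2).trans_le b1
  have q1 : 1 / 2 ≤ massDr Ψ r R / massDr Ψ r r := by rw [le_div_iff₀ hpos]; linarith
  have q2 : massDr Ψ r R / massDr Ψ r r ≤ 2 := by rw [div_le_iff₀ hpos]; linarith
  have k1 : h ≤ massDr Ψ r r / r ^ 2 := by rwa [le_div_iff₀ hr2]
  have k2 : massDr Ψ r r / r ^ 2 ≤ 2 * h := by rwa [div_le_iff₀ hr2]
  have hk : 0 ≤ massDr Ψ r r / r ^ 2 := by positivity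
  rw [Real.mul_rpow (by positivity) hw.le]
  have l1 : (β * h) ^ β ≤ (β * (massDr Ψ r r / r ^ 2)) ^ β :=
    Real.rpow_le_rpow (by positivity) (by gcongr) hβ.le
  have l2 : (β * (massDr Ψ r r / r ^ 2)) ^ β ≤ (β * (2 * h)) ^ β :=
    Real.rpow_le_rpow (by positivity) (by gcongr) hβ.le
  have hw' : 0 < w ^ β := Real.rpow_pos_of_pos hw _
  have hl : 0 < (β * h) ^ β := Real.rpow_pos_of_pos (by positivity) _
  have y1 := B.datum.1.le
  have y2 := B.datum.2.le
  set X := massDr Ψ r R / massDr Ψ r r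
  set Z := (β * (massDr Ψ r r / r ^ 2)) ^ β
  have hX : 0 < X := by linarith
  have hZ : 0 < Z := by linarith
  have hY : 0 < Y₀ r := by linarith
  constructor
  · calc 1 / 4 * (β * h) ^ β * w ^ β = 1 / 2 * ((β * h) ^ β * w ^ β) * (1 / 2) := by ring
      _ ≤ X * (Z * w ^ β) * Y₀ r := by gcongr
  · calc X * (Z * w ^ β) * Y₀ r ≤ 2 * ((β * (2 * h)) ^ β * w ^ β) * 2 := by gcongr
      _ = _ := by ring

theorem effY_pos (B : ShellBounds α h C Ψ Y₀ r) (hα : 0 < α) (hh : 0 < h) (hR : R ∈ Ioc 0 r) :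
    0 < effY α Ψ Y₀ r R := by
  have := B.rarity_pos hR
  exact lt_of_lt_of_le (by positivity) (B.effY_bounds hα hh hR).1

theorem density_rpow_eq (B : ShellBounds α h C Ψ Y₀ r) (hα : 0 < α) (hR : R ∈ Ioc 0 r) :
    density α Ψ r R ^ α =
      (4 * Real.pi * α) ^ (-(α / (α + 1))) * rarity Ψ r R ^ (-(α / (α + 1))) := by
  have hw := B.rarity_pos hR
  have hv := B.massDR_neg R hR
  have hR2 : 0 < R ^ 2 := pow_pos hR.1 2
  have e : -massDR Ψ r R / (4 * Real.pi * α * R ^ 2) = (4 * Real.pi * α * rarity Ψ r R)⁻¹ := by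
    unfold rarity
    field_simp
  have hp : 0 < 4 * Real.pi * α := by positivity
  rw [density, e, ← Real.rpow_mul (by positivity), Real.inv_rpow (by positivity),
    ← Real.rpow_neg (by positivity), Real.mul_rpow hp.le hw.le]
  congr 2 <;> ring

/-- For R ≤ r² both terms of the upper bound on -Ψ_{,R} are O(r⁴). -/
theorem le_rarity (B : ShellBounds α h C Ψ Y₀ r) (hα : 0 < α) (hh : 0 < h)
    (hR : R ∈ Ioc 0 r) (hRr : R ≤ r ^ 2) :
    R ^ 2 / ((3 / 2 * h * (α / (α + 1)) + C) * r ^ 4) ≤ rarity Ψ r R := by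
  have hr := B.pos
  have h1 := B.neg_massDR_le R ⟨hR.1.le, hR.2⟩
  have h2 : R ^ 2 ≤ r ^ 4 := by
    calc R ^ 2 ≤ (r ^ 2) ^ 2 := pow_le_pow_left₀ hR.1.le hRr 2
      _ = r ^ 4 := by ring
  have h3 : 0 < 3 / 2 * h * (α / (α + 1)) := by positivity
  exact div_le_div_of_nonneg_left (sq_nonneg R) (neg_pos.mpr (B.massDR_neg R hR)) (by nlinarith)

theorem abs_mass_sub_le (B : ShellBounds α h C Ψ Y₀ r) (hα : 0 < α) (hh : 0 < h) (hr1 : r ≤ 1)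
    (hR : R ∈ Icc 0 r) (hRr : R ≤ r ^ 2) : |2 * Ψ r R - h * r ^ 3| ≤ (C + h) * r ^ 5 := by
  have hr := B.pos
  have h1 := abs_le.mp (B.mass R hR)
  have hβ0 : 0 < α / (α + 1) := by positivity
  have hβ1 : α / (α + 1) ≤ 1 := (div_le_one (by positivity)).mpr (by linarith)
  have h2 : R ^ 3 ≤ r ^ 5 := by
    calc R ^ 3 ≤ (r ^ 2) ^ 3 := pow_le_pow_left₀ hR.1 hRr 3
      _ = r ^ 5 * r := by ring
      _ ≤ r ^ 5 := mul_le_of_le_one_right (by positivity) hr1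
  have h0 : 0 ≤ R ^ 3 := pow_nonneg hR.1 3
  have h3 : α / (α + 1) * R ^ 3 ≤ r ^ 5 := (mul_le_of_le_one_left h0 hβ1).trans h2
  have h4 : h * (α / (α + 1) * R ^ 3) ≤ h * r ^ 5 := by gcongr
  have h5 : 0 ≤ h * (α / (α + 1) * R ^ 3) := by positivity
  rw [abs_le]
  constructor <;> nlinarith

end ShellBounds

/-! ### Barriers around the horizon and estimates below the upper one -/

/-- The curve `R = h r³ - M r⁵`, a lower barrier for the apparent horizon. -/
def lowerBarrier (h M r : ℝ) : ℝ := h * r ^ 3 - M * r ^ 5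

/-- The curve `R = h r³ + M r⁵`, an upper barrier for the apparent horizon. -/
def upperBarrier (h M r : ℝ) : ℝ := h * r ^ 3 + M * r ^ 5

theorem velocitySq_eq {α : ℝ} {Ψ : ℝ → ℝ → ℝ} {Y₀ : ℝ → ℝ} {r R : ℝ} (hR : R ≠ 0) :
    velocitySq α Ψ Y₀ r R = effY α Ψ Y₀ r R ^ 2 - (R - 2 * Ψ r R) / R := by
  rw [velocitySq, sub_div, div_self hR]
  ring

theorem radiusPrime_pos {α h C : ℝ} {Ψ : ℝ → ℝ → ℝ} {Y₀ : ℝ → ℝ} {r R : ℝ} (hα : 0 < α)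
    (hh : 0 < h) (B : ShellBounds α h C Ψ Y₀ r) (hR : R ∈ Ioc 0 r) :
    0 < radiusPrime α Ψ r R := by
  have h1 : 0 < massDr Ψ r R :=
    (mul_pos hh (pow_pos B.pos 2)).trans_le (B.le_massDr R ⟨hR.1.le, hR.2⟩)
  have h2 := div_neg_of_pos_of_neg h1 (B.massDR_neg R hR)
  have h3 : 0 < α / (α + 1) := by positivity
  unfold radiusPrime
  nlinarith

/-- On or behind the horizon u² = Y² - (R - 2Ψ)/R ≥ Y², so 1 - u/Y ≤ 0 while R' > 0. -/
theorem nullSlope_nonpos {α h C : ℝ} {Ψ : ℝ → ℝ → ℝ} {Y₀ : ℝ → ℝ} {r R : ℝ} (hα : 0 < α)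
    (hh : 0 < h) (B : ShellBounds α h C Ψ Y₀ r) (hR : R ∈ Ioc 0 r) (hm : R ≤ 2 * Ψ r R) :
    nullSlope α Ψ Y₀ r R ≤ 0 := by
  have hY := B.effY_pos hα hh hR
  have h1 : (R - 2 * Ψ r R) / R ≤ 0 := div_nonpos_of_nonpos_of_nonneg (by linarith) hR.1.le
  have h2 : effY α Ψ Y₀ r R ≤ velocity α Ψ Y₀ r R :=
    Real.le_sqrt_of_sq_le (by rw [velocitySq_eq hR.1.ne']; linarith)
  have h3 : 1 ≤ velocity α Ψ Y₀ r R / effY α Ψ Y₀ r R := (one_le_div hY).mpr h2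
  exact mul_nonpos_of_nonneg_of_nonpos (radiusPrime_pos hα hh B hR).le (by linarith)

theorem nullSlope_eq_zero {α h C : ℝ} {Ψ : ℝ → ℝ → ℝ} {Y₀ : ℝ → ℝ} {r R : ℝ} (hα : 0 < α)
    (hh : 0 < h) (B : ShellBounds α h C Ψ Y₀ r) (hR : R ∈ Ioc 0 r) (hm : R = 2 * Ψ r R) :
    nullSlope α Ψ Y₀ r R = 0 := by
  have hY := B.effY_pos hα hh hR
  have h2 : velocity α Ψ Y₀ r R = effY α Ψ Y₀ r R := by
    rw [velocity, velocitySq_eq hR.1.ne', ← hm, sub_self, zero_div, sub_zero, Real.sqrt_sq hY.le]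
  rw [nullSlope, h2, div_self hY.ne', sub_self, mul_zero]

/-- 1 - u/Y = (Y² - u²)/(Y(Y + u)), and u ≤ Y. -/
theorem one_sub_velocity_div_ge {Y u d : ℝ} (hY : 0 < Y) (hu : 0 ≤ u) (hd : 0 ≤ d)
    (h : u ^ 2 = Y ^ 2 - d) : d / (2 * Y ^ 2) ≤ 1 - u / Y := by
  have huY : u ≤ Y := abs_le_of_sq_le_sq' (by linarith) hY.le |>.2
  have e : 1 - u / Y = (Y - u) * (2 * Y) / (2 * Y ^ 2) := by field_simp
  rw [e]
  gcongr
  nlinarith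

/-- The right side is of order r^{4p} with 4p < 2. With p = β it lets Y² absorb an O(r²) error. -/
theorem eventually_mul_sq_le_rpow {A K p : ℝ} (hK : 0 < K) (hp : p < 1 / 2) :
    ∀ᶠ r in 𝓝[>] (0 : ℝ), A * r ^ 2 ≤ K * ((r ^ 2) ^ p) ^ 2 := by
  have h1 : Tendsto (fun r : ℝ => A * r ^ (2 - 4 * p)) (𝓝[>] 0) (𝓝 (A * 0)) := by
    refine Tendsto.const_mul A ?_
    have := (Real.continuousAt_rpow_const 0 (2 - 4 * p) (Or.inr (by linarith))).tendsto
    rw [Real.zero_rpow (by linarith)] at this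
    exact this.mono_left nhdsWithin_le_nhds
  rw [mul_zero] at h1
  filter_upwards [h1.eventually_lt_const hK, self_mem_nhdsWithin] with r hr (h0 : 0 < r)
  have e1 : ((r ^ 2) ^ p) ^ 2 = r ^ (4 * p) := by
    rw [← Real.rpow_natCast r 2, ← Real.rpow_mul h0.le, ← Real.rpow_natCast _ 2,
      ← Real.rpow_mul h0.le]
    congr 1
    push_cast
    ring
  have e2 : r ^ 2 = r ^ (2 - 4 * p) * r ^ (4 * p) := by
    rw [← Real.rpow_add h0, ← Real.rpow_natCast r 2]
    congr 1
    push_cast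
    ring
  rw [e1, e2, ← mul_assoc]
  gcongr

theorem eventually_polynomial_lt {A B k K : ℝ} (hk : 0 < k) (hK : 0 < K) :
    ∀ᶠ r in 𝓝[>] (0 : ℝ), A * r < k ∧ A * r ^ 2 < k ∧ A * r ^ 2 + B * r ^ 4 < K := by
  have t1 : Tendsto (fun r : ℝ => A * r) (𝓝[>] 0) (𝓝 (A * 0)) :=
    (Continuous.tendsto (by fun_prop) 0).mono_left nhdsWithin_le_nhds
  have t2 : Tendsto (fun r : ℝ => A * r ^ 2) (𝓝[>] 0) (𝓝 (A * 0 ^ 2)) :=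
    (Continuous.tendsto (by fun_prop) 0).mono_left nhdsWithin_le_nhds
  have t3 : Tendsto (fun r : ℝ => A * r ^ 2 + B * r ^ 4) (𝓝[>] 0) (𝓝 (A * 0 ^ 2 + B * 0 ^ 4)) :=
    (Continuous.tendsto (by fun_prop) 0).mono_left nhdsWithin_le_nhds
  exact (t1.eventually_lt_const (by simpa using hk)).and
    ((t2.eventually_lt_const (by simpa using hk)).and (t3.eventually_lt_const (by simpa using hK)))

/-- The facts about the region below the upper barrier that the geodesic argument uses. -/
structure BarrierBounds (α h M K : ℝ) (Ψ : ℝ → ℝ → ℝ) (Y₀ : ℝ → ℝ) (r : ℝ) : Prop where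
  lower_pos : 0 < lowerBarrier h M r
  upper_le : upperBarrier h M r ≤ 2 * h * r ^ 3
  upper_lt : upperBarrier h M r < r
  lower_lt_mass : lowerBarrier h M r < 2 * Ψ r (lowerBarrier h M r)
  mass_lt_upper : 2 * Ψ r (upperBarrier h M r) < upperBarrier h M r
  velocitySq_pos : ∀ R ∈ Ioc 0 (upperBarrier h M r), 0 < velocitySq α Ψ Y₀ r R
  timeDensity_le : ∀ R ∈ Ioc 0 (upperBarrier h M r),
    timeDensity α Ψ Y₀ r R ≤ K * R ^ (-(2 * (α / (α + 1))))
  lower_slope : 0 < 3 * h * r ^ 2 - 5 * M * r ^ 4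
  upper_slope : 3 * h * r ^ 2 + 5 * M * r ^ 4 <
    nullSlope α Ψ Y₀ r (upperBarrier h M r)

set_option maxHeartbeats 1600000 in
theorem exists_barrierBounds {α h C : ℝ} {Ψ : ℝ → ℝ → ℝ} {Y₀ : ℝ → ℝ} (hα : 0 < α) (hα1 : α < 1)
    (hh : 0 < h) (hC : 0 < C) (hB : ∀ᶠ r in 𝓝[>] (0 : ℝ), ShellBounds α h C Ψ Y₀ r) :
    ∃ M > 0, ∃ K > 0, ∀ᶠ r in 𝓝[>] (0 : ℝ), BarrierBounds α h M K Ψ Y₀ r := by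
  have hβ : 0 < α / (α + 1) := by positivity
  have hβ2 : α / (α + 1) < 1 / 2 := by rw [div_lt_div_iff₀ (by positivity) (by norm_num)]; linarith
  obtain ⟨β, hβdef⟩ : ∃ β, β = α / (α + 1) := ⟨_, rfl⟩
  rw [← hβdef] at hβ hβ2
  obtain ⟨D, hD⟩ : ∃ x, x = 3 / 2 * h * β + C := ⟨_, rfl⟩
  have hDpos : 0 < D := by rw [hD]; positivity
  -- |2Ψ - h r³| ≤ (C + h) r⁵ for R ≤ r²; the extra 1 leaves a margin r⁵ between R and 2Ψ on each
  -- barrier.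
  obtain ⟨M, hM⟩ : ∃ x, x = C + h + 1 := ⟨_, rfl⟩
  have hMpos : 0 < M := by rw [hM]; positivity
  obtain ⟨c₁, hc₁⟩ : ∃ x, x = 1 / 4 * (β * h) ^ β := ⟨_, rfl⟩
  obtain ⟨c₂, hc₂⟩ : ∃ x, x = 4 * (β * (2 * h)) ^ β := ⟨_, rfl⟩
  obtain ⟨c₃, hc₃⟩ : ∃ x, x = (4 * Real.pi * α) ^ (-β) := ⟨_, rfl⟩
  have hc₁p : 0 < c₁ := by rw [hc₁]; positivity
  have hc₂p : 0 < c₂ := by rw [hc₂]; positivity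
  have hc₃p : 0 < c₃ := by rw [hc₃]; positivity
  -- Chosen so that R ≥ (h/2) r³ gives w ≥ R²/(D r⁴) ≥ e r².
  obtain ⟨e, he⟩ : ∃ x, x = h ^ 2 / (4 * D) := ⟨_, rfl⟩
  have hep : 0 < e := by rw [he]; positivity
  -- Lower bound for the null slope on the upper barrier.
  obtain ⟨k, hk⟩ : ∃ x, x = β / (16 * h ^ 2 * c₂ ^ 2) * e ^ (1 - 2 * β) := ⟨_, rfl⟩
  have hkp : 0 < k := by rw [hk]; positivity
  -- One summand for each of the two ranges of R in the bound on ρ^α/u.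
  obtain ⟨K, hK⟩ : ∃ x, x = 2 * c₃ / c₁ * (h / (4 * D)) ^ (-(2 * β)) + c₃ * (1 / D) ^ (-β) := ⟨_, rfl⟩
  refine ⟨M, hMpos, K, by rw [hK]; positivity, ?_⟩
  have hev1 := eventually_mul_sq_le_rpow (A := 4 * M / h) (K := 1 / 2 * (c₁ * e ^ β) ^ 2)
    (p := β) (by positivity) hβ2
  have hev2 := eventually_polynomial_lt (A := 3 * h) (B := 5 * M) one_pos hkp
  have hev3 := eventually_polynomial_lt (A := M) (B := 0) (show 0 < h / 2 by positivity) one_pos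
  filter_upwards [hB, hev1, hev2, hev3, Ioo_mem_nhdsGT (one_pos : (0 : ℝ) < 1)] with r B h1 h2 h3 h4
  have hr := B.pos
  have hr1 : r ≤ 1 := h4.2.le
  have hr2 : 0 < r ^ 2 := by positivity
  have hr3 : 0 < r ^ 3 := by positivity
  have hr5 : 0 < r ^ 5 := by positivity
  have hM5 : M * r ^ 5 ≤ h / 2 * r ^ 3 := by
    calc M * r ^ 5 = M * r ^ 2 * r ^ 3 := by ring
      _ ≤ h / 2 * r ^ 3 := by gcongr; exact h3.2.1.le
  set S := upperBarrier h M r with hS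
  set Lo := lowerBarrier h M r with hLo
  have hS' : S = h * r ^ 3 + M * r ^ 5 := rfl
  have hLo' : Lo = h * r ^ 3 - M * r ^ 5 := rfl
  have hS2 : S ≤ 2 * h * r ^ 3 := by rw [hS']; linarith [mul_pos hh hr3]
  have hSpos : 0 < S := by rw [hS']; positivity
  have hMr5 : 0 < M * r ^ 5 := by positivity
  have hLoS : Lo ≤ S := by rw [hLo', hS']; linarith
  have hSr2 : S ≤ r ^ 2 := hS2.trans <| by
    calc 2 * h * r ^ 3 = 2 * h * r * r ^ 2 := by ring
      _ ≤ 1 * r ^ 2 := by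
        gcongr
        linarith [h2.1, mul_pos hh hr]
      _ = r ^ 2 := one_mul _
  have hr2r : r ^ 2 < r := by
    rw [sq]
    exact mul_lt_of_lt_one_right hr h4.2
  have hSr : S < r := hSr2.trans_lt hr2r
  have hLopos : 0 < Lo := by
    rw [hLo']
    linarith [mul_pos hh hr3]
  have hIoc : ∀ R ∈ Ioc 0 S, R ∈ Ioc 0 r := fun R hR => ⟨hR.1, hR.2.trans hSr.le⟩
  have hmass : ∀ R ∈ Ioc 0 S, |2 * Ψ r R - h * r ^ 3| ≤ M * r ^ 5 - r ^ 5 := fun R hR => by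
    have := B.abs_mass_sub_le hα hh hr1 ⟨hR.1.le, hR.2.trans hSr.le⟩ (hR.2.trans hSr2)
    rwa [show C + h = M - 1 by rw [hM]; ring, sub_one_mul] at this
  have hmass_le : ∀ R ∈ Ioc 0 S, R - 2 * Ψ r R ≤ 2 * M * r ^ 5 := fun R hR => by
    have := (abs_le.mp (hmass R hR)).1
    linarith [hR.2]
  have hmass_ge : ∀ R ∈ Ioc 0 S, h / 2 * r ^ 3 ≤ 2 * Ψ r R := fun R hR => by
    have := (abs_le.mp (hmass R hR)).1
    linarith
  have hSS : S ∈ Ioc 0 S := ⟨hSpos, le_rfl⟩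
  have hw : ∀ R ∈ Ioc 0 S, R ^ 2 / (D * r ^ 4) ≤ rarity Ψ r R := fun R hR => by
    have := B.le_rarity hα hh (hIoc R hR) (hR.2.trans hSr2)
    rwa [← hβdef, ← hD] at this
  have hwe : ∀ R ∈ Ioc 0 S, h / 2 * r ^ 3 ≤ R → e * r ^ 2 ≤ rarity Ψ r R := fun R hR hRge => by
    refine le_trans ?_ (hw R hR)
    rw [le_div_iff₀ (by positivity)]
    calc e * r ^ 2 * (D * r ^ 4) = (h / 2 * r ^ 3) ^ 2 := by rw [he]; field_simp; ring
      _ ≤ R ^ 2 := by gcongr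
  have hY : ∀ R ∈ Ioc 0 S, c₁ * rarity Ψ r R ^ β ≤ effY α Ψ Y₀ r R ∧
      effY α Ψ Y₀ r R ≤ c₂ * rarity Ψ r R ^ β := fun R hR => by
    have := B.effY_bounds hα hh (hIoc R hR)
    rwa [← hβdef, ← hc₁, ← hc₂] at this
  have hYpos : ∀ R ∈ Ioc 0 S, 0 < effY α Ψ Y₀ r R := fun R hR => B.effY_pos hα hh (hIoc R hR)
  have hwpos : ∀ R ∈ Ioc 0 S, 0 < rarity Ψ r R := fun R hR => B.rarity_pos (hIoc R hR)
  have hvel : ∀ R ∈ Ioc 0 S, effY α Ψ Y₀ r R ^ 2 / 2 ≤ velocitySq α Ψ Y₀ r R := fun R hR => by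
    rw [velocitySq_eq hR.1.ne']
    suffices (R - 2 * Ψ r R) / R ≤ effY α Ψ Y₀ r R ^ 2 / 2 by linarith
    -- Before the horizon R ≥ (h/2) r³, so Y² ≳ r^{4β} dominates (R - 2Ψ)/R = O(r²).
    rcases le_or_gt R (2 * Ψ r R) with hle | hgt
    · exact (div_nonpos_of_nonpos_of_nonneg (by linarith) hR.1.le).trans (by positivity)
    · have hRge : h / 2 * r ^ 3 ≤ R := (hmass_ge R hR).trans hgt.le
      have hYge : c₁ * e ^ β * (r ^ 2) ^ β ≤ effY α Ψ Y₀ r R := by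
        refine le_trans ?_ (hY R hR).1
        rw [mul_assoc, ← Real.mul_rpow hep.le hr2.le]
        gcongr
        exact hwe R hR hRge
      calc (R - 2 * Ψ r R) / R ≤ 2 * M * r ^ 5 / (h / 2 * r ^ 3) := by
            gcongr
            exact hmass_le R hR
        _ = 4 * M / h * r ^ 2 := by field_simp; ring
        _ ≤ 1 / 2 * (c₁ * e ^ β) ^ 2 * ((r ^ 2) ^ β) ^ 2 := h1
        _ = (c₁ * e ^ β * (r ^ 2) ^ β) ^ 2 / 2 := by ring
        _ ≤ effY α Ψ Y₀ r R ^ 2 / 2 := by gcongr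
  refine ⟨hLopos, hS2, hSr, ?_, ?_, fun R hR => ?_, fun R hR => ?_, ?_, ?_⟩
  · have := (abs_le.mp (hmass Lo ⟨hLopos, hLoS⟩)).1
    linarith
  · have := (abs_le.mp (hmass S hSS)).2
    linarith
  · exact lt_of_lt_of_le (by have := hYpos R hR; positivity) (hvel R hR)
  · rw [← hβdef]
    have hwp := hwpos R hR
    have hRp := hR.1
    have hdens := B.density_rpow_eq hα (hIoc R hR)
    rw [← hβdef, ← hc₃] at hdens
    rw [timeDensity, hdens]
    have t1 : 0 ≤ 2 * c₃ / c₁ * (h / (4 * D)) ^ (-(2 * β)) := by positivity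
    have t2 : 0 ≤ c₃ * (1 / D) ^ (-β) := by positivity
    have hRpow : 0 ≤ R ^ (-(2 * β)) := by positivity
    -- For R ≥ (h/4) r³, u ≳ Y gives ρ^α/u ≲ w^{-2β}, with w ≳ R. For smaller R, 2Ψ/R ≥ 2 gives u ≥
    -- 1, and ρ^α ≲ w^{-β} with w ≳ R². Either way the exponent is -2β.
    rcases le_or_gt (h / 4 * r ^ 3) R with hge | hlt
    · have hu : c₁ / 2 * rarity Ψ r R ^ β ≤ velocity α Ψ Y₀ r R := by
        refine Real.le_sqrt_of_sq_le ((?_ : _ ≤ effY α Ψ Y₀ r R ^ 2 / 2).trans (hvel R hR))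
        have := pow_le_pow_left₀ (by positivity) (hY R hR).1 2
        linarith [sq_nonneg (c₁ * rarity Ψ r R ^ β)]
      have hwR : h / (4 * D) * R ≤ rarity Ψ r R := by
        refine le_trans ?_ (hw R hR)
        rw [le_div_iff₀ (by positivity)]
        have : h / 4 * r ^ 4 ≤ R := by
          refine le_trans ?_ hge
          have : r ^ 4 ≤ r ^ 3 := pow_le_pow_of_le_one hr.le hr1 (by norm_num)
          gcongr
        calc h / (4 * D) * R * (D * r ^ 4) = h / 4 * r ^ 4 * R := by field_simp
          _ ≤ R * R := by gcongr
          _ = R ^ 2 := by ring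
      calc c₃ * rarity Ψ r R ^ (-β) / velocity α Ψ Y₀ r R
          ≤ c₃ * rarity Ψ r R ^ (-β) / (c₁ / 2 * rarity Ψ r R ^ β) := by gcongr
        _ = 2 * c₃ / c₁ * rarity Ψ r R ^ (-(2 * β)) := by
            rw [show -(2 * β) = -β - β by ring, Real.rpow_sub hwp]
            field_simp
        _ ≤ 2 * c₃ / c₁ * (h / (4 * D) * R) ^ (-(2 * β)) := by
            gcongr 2 * c₃ / c₁ * ?_
            exact Real.rpow_le_rpow_of_nonpos (by positivity) hwR (by linarith)
        _ = 2 * c₃ / c₁ * (h / (4 * D)) ^ (-(2 * β)) * R ^ (-(2 * β)) := by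
            rw [Real.mul_rpow (by positivity) hRp.le, mul_assoc]
        _ ≤ K * R ^ (-(2 * β)) := by
            gcongr
            rw [hK]
            linarith
    · have hu : 1 ≤ velocity α Ψ Y₀ r R := by
        refine Real.le_sqrt_of_sq_le ?_
        have hq : 2 ≤ 2 * Ψ r R / R := by
          rw [le_div_iff₀ hRp]
          linarith [hmass_ge R hR]
        rw [velocitySq]
        linarith [sq_nonneg (effY α Ψ Y₀ r R)]
      have hwR : 1 / D * R ^ 2 ≤ rarity Ψ r R := by
        refine le_trans ?_ (hw R hR)
        rw [one_div_mul_eq_div]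
        gcongr
        exact mul_le_of_le_one_right hDpos.le (pow_le_one₀ hr.le hr1)
      calc c₃ * rarity Ψ r R ^ (-β) / velocity α Ψ Y₀ r R
          ≤ c₃ * rarity Ψ r R ^ (-β) := div_le_self (by positivity) hu
        _ ≤ c₃ * (1 / D * R ^ 2) ^ (-β) := by
            gcongr c₃ * ?_
            exact Real.rpow_le_rpow_of_nonpos (by positivity) hwR (by linarith)
        _ = c₃ * (1 / D) ^ (-β) * R ^ (-(2 * β)) := by
            rw [Real.mul_rpow (by positivity) (by positivity), ← Real.rpow_natCast R 2,
              ← Real.rpow_mul hRp.le, mul_assoc]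
            congr 3
            push_cast
            ring
        _ ≤ K * R ^ (-(2 * β)) := by
            gcongr
            rw [hK]
            linarith
  · have : M * r ^ 4 ≤ h / 2 * r ^ 2 := by
      calc M * r ^ 4 = M * r ^ 2 * r ^ 2 := by ring
        _ ≤ h / 2 * r ^ 2 := by gcongr; exact h3.2.1.le
    linarith [mul_pos hh hr2]
  · refine h2.2.2.trans_le ?_
    have hSI := hIoc S hSS
    have hYS := hYpos S hSS
    have hwS := hwpos S hSS
    have hd : r ^ 5 ≤ S - 2 * Ψ r S := by
      have := (abs_le.mp (hmass S hSS)).2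
      linarith
    have hdS : r ^ 2 / (2 * h) ≤ (S - 2 * Ψ r S) / S := by
      calc r ^ 2 / (2 * h) = r ^ 5 / (2 * h * r ^ 3) := by field_simp
        _ ≤ (S - 2 * Ψ r S) / S := by gcongr; exact hr5.le.trans hd
    have hu : velocity α Ψ Y₀ r S ^ 2 = effY α Ψ Y₀ r S ^ 2 - (S - 2 * Ψ r S) / S := by
      rw [velocity, Real.sq_sqrt ((by positivity : 0 ≤ effY α Ψ Y₀ r S ^ 2 / 2).trans (hvel S hSS)),
        velocitySq_eq hSpos.ne']
    have h1u := one_sub_velocity_div_ge hYS (Real.sqrt_nonneg _)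
      ((by positivity : 0 ≤ r ^ 2 / (2 * h)).trans hdS) hu
    have hRp : β * (h * r ^ 2) * rarity Ψ r S / (2 * h * r ^ 3) ^ 2 ≤ radiusPrime α Ψ r S := by
      have e1 : radiusPrime α Ψ r S = β * massDr Ψ r S * rarity Ψ r S / S ^ 2 := by
        have := (B.massDR_neg S hSI).ne
        rw [radiusPrime, rarity, ← hβdef]
        field_simp
      rw [e1]
      have := B.le_massDr S ⟨hSpos.le, hSr.le⟩
      have hpos : 0 ≤ massDr Ψ r S := le_trans (by positivity) this
      gcongr
    have hq : r ^ 2 / (2 * h) / (2 * (c₂ * rarity Ψ r S ^ β) ^ 2) ≤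
        1 - velocity α Ψ Y₀ r S / effY α Ψ Y₀ r S := by
      refine le_trans ?_ h1u
      have := (hY S hSS).2
      have hpos : 0 ≤ (S - 2 * Ψ r S) / S := le_trans (by positivity) hdS
      gcongr
    -- Since r ≤ 1 and 0 < 1 - 2β ≤ 1, (r²)^{1-2β} ≥ r²; this cancels the factor 1/r² in the slope.
    have hwge : e ^ (1 - 2 * β) * r ^ 2 ≤ rarity Ψ r S ^ (1 - 2 * β) := by
      calc e ^ (1 - 2 * β) * r ^ 2 ≤ e ^ (1 - 2 * β) * (r ^ 2) ^ (1 - 2 * β) := by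
            gcongr
            exact Real.self_le_rpow_of_le_one hr2.le (pow_le_one₀ hr.le hr1) (by linarith)
        _ = (e * r ^ 2) ^ (1 - 2 * β) := (Real.mul_rpow hep.le hr2.le).symm
        _ ≤ _ := Real.rpow_le_rpow (by positivity) (hwe S hSS (by linarith [mul_pos hh hr3])) (by linarith)
    calc k = β / (16 * h ^ 2 * c₂ ^ 2) * (e ^ (1 - 2 * β) * r ^ 2) / r ^ 2 := by
          rw [hk]; field_simp
      _ ≤ β / (16 * h ^ 2 * c₂ ^ 2) * rarity Ψ r S ^ (1 - 2 * β) / r ^ 2 := by gcongr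
      _ = β * (h * r ^ 2) * rarity Ψ r S / (2 * h * r ^ 3) ^ 2 *
          (r ^ 2 / (2 * h) / (2 * (c₂ * rarity Ψ r S ^ β) ^ 2)) := by
          rw [show 1 - 2 * β = 1 - β - β by ring, Real.rpow_sub hwS, Real.rpow_sub hwS,
            Real.rpow_one]
          field_simp
          ring
      _ ≤ nullSlope α Ψ Y₀ r S :=
          mul_le_mul hRp hq (by positivity) (radiusPrime_pos hα hh B hSI).le

/-! ### Regularity of the null slope and the clamped equation -/

variable {α h C M K : ℝ} {Ψ : ℝ → ℝ → ℝ} {Y₀ : ℝ → ℝ}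

/-- The null slope as a function of `r`, `R` and the value of the datum. -/
noncomputable def nullSlopeFun (α : ℝ) (Ψ : ℝ → ℝ → ℝ) (p : ℝ × ℝ × ℝ) : ℝ :=
  nullSlope α Ψ (fun _ => p.2.2) p.1 p.2.1

theorem contDiffAt_effY {p : ℝ × ℝ × ℝ} (h1 : AnalyticAt ℝ (Function.uncurry Ψ) (p.1, p.2.1))
    (h2 : AnalyticAt ℝ (Function.uncurry Ψ) (p.1, p.1)) (hr : p.1 ≠ 0) (hR : p.2.1 ≠ 0)
    (hdr : massDr Ψ p.1 p.1 ≠ 0) (hdR₀ : massDR Ψ p.1 p.1 ≠ 0) (hdR : massDR Ψ p.1 p.2.1 ≠ 0) :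
    ContDiffAt ℝ 1 (fun q : ℝ × ℝ × ℝ => effY α Ψ (fun _ => q.2.2) q.1 q.2.1) p := by
  have i1 : ContDiffAt ℝ 1 (fun q : ℝ × ℝ × ℝ => (q.1, q.2.1)) p := by fun_prop
  have i2 : ContDiffAt ℝ 1 (fun q : ℝ × ℝ × ℝ => (q.1, q.1)) p := by fun_prop
  have a1 : ContDiffAt ℝ 1 (fun q : ℝ × ℝ × ℝ => massDr Ψ q.1 q.2.1) p :=
    ContDiffAt.comp (g := Function.uncurry (massDr Ψ)) p (contDiffAt_massDr h1) i1
  have a2 : ContDiffAt ℝ 1 (fun q : ℝ × ℝ × ℝ => massDr Ψ q.1 q.1) p :=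
    ContDiffAt.comp (g := Function.uncurry (massDr Ψ)) p (contDiffAt_massDr h2) i2
  have a3 : ContDiffAt ℝ 1 (fun q : ℝ × ℝ × ℝ => massDR Ψ q.1 q.2.1) p :=
    ContDiffAt.comp (g := Function.uncurry (massDR Ψ)) p (contDiffAt_massDR h1) i1
  have a4 : ContDiffAt ℝ 1 (fun q : ℝ × ℝ × ℝ => massDR Ψ q.1 q.1) p :=
    ContDiffAt.comp (g := Function.uncurry (massDR Ψ)) p (contDiffAt_massDR h2) i2
  have a5 : ContDiffAt ℝ 1 (fun q : ℝ × ℝ × ℝ => q.1) p := by fun_prop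
  have a6 : ContDiffAt ℝ 1 (fun q : ℝ × ℝ × ℝ => q.2.1) p := by fun_prop
  have a7 : ContDiffAt ℝ 1 (fun q : ℝ × ℝ × ℝ => q.2.2) p := by fun_prop
  unfold effY
  refine ((a1.div a2 hdr).mul (ContDiffAt.rpow_const_of_ne
    ((a4.mul (a6.pow 2)).div (a3.mul (a5.pow 2)) (mul_ne_zero hdR (pow_ne_zero 2 hr))) ?_)).mul a7
  exact div_ne_zero (mul_ne_zero hdR₀ (pow_ne_zero 2 hR)) (mul_ne_zero hdR (pow_ne_zero 2 hr))

/-- `Y₀` is only continuous, so the slope need not be differentiable in r. Treating the datum as an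
independent variable gives a C¹ function, hence a Lipschitz bound in R. -/
theorem ShellBounds.contDiffAt_nullSlopeFun {r R : ℝ} (hα : 0 < α) (hh : 0 < h)
    (B : ShellBounds α h C Ψ Y₀ r) (hR : R ∈ Ioc 0 r) (hv : 0 < velocitySq α Ψ Y₀ r R) :
    ContDiffAt ℝ 1 (nullSlopeFun α Ψ) (r, R, Y₀ r) := by
  have hRI : R ∈ Icc 0 r := ⟨hR.1.le, hR.2⟩
  have hrI : r ∈ Icc 0 r := ⟨B.pos.le, le_rfl⟩
  have hmr : massDr Ψ r r ≠ 0 :=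
    ((mul_pos hh (pow_pos B.pos 2)).trans_le (B.le_massDr r hrI)).ne'
  have hmR := (B.massDR_neg R hR).ne
  have hY := contDiffAt_effY (α := α) (p := (r, R, Y₀ r)) (B.analytic R hRI) (B.analytic r hrI)
    B.pos.ne' hR.1.ne' hmr (B.massDR_neg r ⟨B.pos, le_rfl⟩).ne hmR
  have i1 : ContDiffAt ℝ 1 (fun q : ℝ × ℝ × ℝ => (q.1, q.2.1)) (r, R, Y₀ r) := by fun_prop
  have a0 : ContDiffAt ℝ 1 (fun q : ℝ × ℝ × ℝ => Ψ q.1 q.2.1) (r, R, Y₀ r) :=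
    ContDiffAt.comp (g := Function.uncurry Ψ) (r, R, Y₀ r) (B.analytic R hRI).contDiffAt i1
  have a1 : ContDiffAt ℝ 1 (fun q : ℝ × ℝ × ℝ => massDr Ψ q.1 q.2.1) (r, R, Y₀ r) :=
    ContDiffAt.comp (g := Function.uncurry (massDr Ψ)) (r, R, Y₀ r)
      (contDiffAt_massDr (B.analytic R hRI)) i1
  have a3 : ContDiffAt ℝ 1 (fun q : ℝ × ℝ × ℝ => massDR Ψ q.1 q.2.1) (r, R, Y₀ r) :=
    ContDiffAt.comp (g := Function.uncurry (massDR Ψ)) (r, R, Y₀ r)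
      (contDiffAt_massDR (B.analytic R hRI)) i1
  have a6 : ContDiffAt ℝ 1 (fun q : ℝ × ℝ × ℝ => q.2.1) (r, R, Y₀ r) := by fun_prop
  have av : ContDiffAt ℝ 1 (fun q : ℝ × ℝ × ℝ => velocity α Ψ (fun _ => q.2.2) q.1 q.2.1)
      (r, R, Y₀ r) := by
    unfold velocity velocitySq
    exact ((((contDiffAt_const.mul a0).div a6 hR.1.ne').add (hY.pow 2)).sub
      contDiffAt_const).sqrt hv.ne'
  unfold nullSlopeFun nullSlope radiusPrime
  exact (contDiffAt_const.mul (a1.div a3 hmR)).mul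
    (contDiffAt_const.sub (av.div hY (B.effY_pos hα hh hR).ne'))

theorem continuous_lowerBarrier : Continuous (lowerBarrier h M) := by
  unfold lowerBarrier; fun_prop

theorem continuous_upperBarrier : Continuous (upperBarrier h M) := by
  unfold upperBarrier; fun_prop

/-- The null slope with the area radius clamped between the two barriers. -/
noncomputable def clampedSlope (α h M : ℝ) (Ψ : ℝ → ℝ → ℝ) (Y₀ : ℝ → ℝ) (r R : ℝ) : ℝ :=
  nullSlope α Ψ Y₀ r (max (lowerBarrier h M r) (min (upperBarrier h M r) R))

theorem clampedSlope_eq {r R : ℝ} (h1 : lowerBarrier h M r ≤ R) (h2 : R ≤ upperBarrier h M r) :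
    clampedSlope α h M Ψ Y₀ r R = nullSlope α Ψ Y₀ r R := by
  rw [clampedSlope, min_eq_right h2, max_eq_right h1]

theorem lipschitzWith_clamp (l u : ℝ) : LipschitzWith 1 fun x : ℝ => max l (min u x) :=
  (LipschitzWith.id.const_min u).const_max l

/-- Between the barriers with r ∈ [a, b] the region is compact and u, Y stay positive, so the slope
and its R-derivative are bounded; clamping extends this to every real R. -/
theorem clampedSlope_lipschitz (hα : 0 < α) (hh : 0 < h) (hM : 0 < M) {b : ℝ}
    (hB : ∀ r ∈ Ioc 0 b, ShellBounds α h C Ψ Y₀ r)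
    (hE : ∀ r ∈ Ioc 0 b, BarrierBounds α h M K Ψ Y₀ r) {a : ℝ} (ha : a ∈ Ioo 0 b) :
    ∃ k A : ℝ≥0, (∀ t ∈ Icc a b, LipschitzWith k (clampedSlope α h M Ψ Y₀ t)) ∧
      (∀ x, ContinuousOn (clampedSlope α h M Ψ Y₀ · x) (Icc a b)) ∧
      ∀ t ∈ Icc a b, ∀ x, ‖clampedSlope α h M Ψ Y₀ t x‖ ≤ A := by
  have hIoc : ∀ r ∈ Icc a b, r ∈ Ioc 0 b := fun r hr => ⟨ha.1.trans_le hr.1, hr.2⟩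
  have hle : ∀ r ∈ Icc a b, lowerBarrier h M r ≤ upperBarrier h M r := fun r hr => by
    have := ha.1.trans_le hr.1
    have : 0 < M * r ^ 5 := by positivity
    unfold lowerBarrier upperBarrier
    linarith
  set Q : Set (ℝ × ℝ) := {q | q.1 ∈ Icc a b ∧ lowerBarrier h M q.1 ≤ q.2 ∧
    q.2 ≤ upperBarrier h M q.1} with hQ
  have hQc : IsCompact Q := by
    refine ((isCompact_Icc (a := a) (b := b)).prod (isCompact_Icc (a := (0 : ℝ)) (b := b))).of_isClosed_subset ?_ ?_
    · exact (isClosed_Icc.preimage continuous_fst).inter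
        ((isClosed_le (continuous_lowerBarrier.comp continuous_fst) continuous_snd).inter
          (isClosed_le continuous_snd (continuous_upperBarrier.comp continuous_fst)))
    · rintro ⟨r, R⟩ ⟨h1, h2, h3⟩
      have E := hE r (hIoc r h1)
      exact ⟨h1, E.lower_pos.le.trans h2, h3.trans (E.upper_lt.le.trans h1.2)⟩
  have hcd : ∀ q ∈ Q, ContDiffAt ℝ 1 (nullSlopeFun α Ψ) (q.1, q.2, Y₀ q.1) := by
    rintro ⟨r, R⟩ ⟨h1, h2, h3⟩
    have E := hE r (hIoc r h1)
    have hR0 := E.lower_pos.trans_le h2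
    exact (hB r (hIoc r h1)).contDiffAt_nullSlopeFun hα hh ⟨hR0, h3.trans E.upper_lt.le⟩
      (E.velocitySq_pos R ⟨hR0, h3⟩)
  have hιc : ContinuousOn (fun q : ℝ × ℝ => (q.1, q.2, Y₀ q.1)) Q := by
    intro q hq
    have : ContinuousAt (fun q : ℝ × ℝ => Y₀ q.1) q :=
      ContinuousAt.comp (g := Y₀) (hB q.1 (hIoc _ hq.1)).datum_cont continuousAt_fst
    exact (continuousAt_fst.prodMk (continuousAt_snd.prodMk this)).continuousWithinAt
  have hfc : ContinuousOn (fun q : ℝ × ℝ => nullSlopeFun α Ψ (q.1, q.2, Y₀ q.1)) Q :=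
    fun q hq => ContinuousAt.comp_continuousWithinAt (f := fun q : ℝ × ℝ => (q.1, q.2, Y₀ q.1))
      (hcd q hq).continuousAt (hιc q hq)
  have hdc : ContinuousOn (fun q : ℝ × ℝ => fderiv ℝ (nullSlopeFun α Ψ) (q.1, q.2, Y₀ q.1)) Q :=
    fun q hq => ContinuousAt.comp_continuousWithinAt (f := fun q : ℝ × ℝ => (q.1, q.2, Y₀ q.1))
      ((hcd q hq).continuousAt_fderiv one_ne_zero) (hιc q hq)
  obtain ⟨A, hA⟩ := hQc.exists_bound_of_continuousOn hfc
  obtain ⟨k, hk⟩ := hQc.exists_bound_of_continuousOn hdc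
  have hclamp : ∀ r ∈ Icc a b, ∀ x,
      (r, max (lowerBarrier h M r) (min (upperBarrier h M r) x)) ∈ Q := fun r hr x =>
    ⟨hr, le_max_left _ _, max_le (hle r hr) (min_le_left _ _)⟩
  refine ⟨k.toNNReal, A.toNNReal, fun r hr => ?_, fun x => ?_, fun r hr x => ?_⟩
  · have hlip : LipschitzOnWith k.toNNReal (fun R => nullSlope α Ψ Y₀ r R)
        (Icc (lowerBarrier h M r) (upperBarrier h M r)) := by
      refine (convex_Icc _ _).lipschitzOnWith_of_nnnorm_hasDerivWithin_le
        (f' := fun R => fderiv ℝ (nullSlopeFun α Ψ) (r, R, Y₀ r) (0, 1, 0)) (fun R hR => ?_)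
        (fun R hR => ?_)
      · have hq : (r, R) ∈ Q := ⟨hr, hR⟩
        have := ((hcd _ hq).differentiableAt one_ne_zero).hasFDerivAt
        exact (HasFDerivAt.comp_hasDerivAt (f := fun S => (r, S, Y₀ r)) R this
          ((hasDerivAt_const R r).prodMk
            ((hasDerivAt_id R).prodMk (hasDerivAt_const R (Y₀ r))))).hasDerivWithinAt
      · rw [← NNReal.coe_le_coe, coe_nnnorm]
        refine le_trans ?_ (Real.le_coe_toNNReal k)
        refine ((fderiv ℝ (nullSlopeFun α Ψ) (r, R, Y₀ r)).le_opNorm _).trans ?_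
        refine (mul_le_of_le_one_right (norm_nonneg _) (by simp [Prod.norm_def])).trans ?_
        exact hk (r, R) ⟨hr, hR⟩
    have := hlip.comp (lipschitzWith_clamp (lowerBarrier h M r)
      (upperBarrier h M r)).lipschitzOnWith (s := univ) fun x _ => (hclamp r hr x).2
    rw [mul_one, lipschitzOnWith_univ] at this
    exact this
  · refine hfc.comp (f := fun r => (r, max (lowerBarrier h M r) (min (upperBarrier h M r) x)))
      ?_ fun r hr => hclamp r hr x
    exact (continuous_id.prodMk (continuous_lowerBarrier.max
      (continuous_upperBarrier.min continuous_const))).continuousOn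
  · exact (hA _ (hclamp r hr x)).trans (Real.le_coe_toNNReal A)

/-! ### The apparent horizon -/

theorem lowerBarrier_lt_upperBarrier {r : ℝ} (hM : 0 < M) (hr : 0 < r) :
    lowerBarrier h M r < upperBarrier h M r := by
  have : 0 < M * r ^ 5 := by positivity
  unfold lowerBarrier upperBarrier
  linarith

theorem hasDerivAt_lowerBarrier (r : ℝ) :
    HasDerivAt (lowerBarrier h M) (3 * h * r ^ 2 - 5 * M * r ^ 4) r := by
  refine (((hasDerivAt_pow 3 r).const_mul h).sub ((hasDerivAt_pow 5 r).const_mul M)).congr_deriv ?_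
  norm_num
  ring

theorem hasDerivAt_upperBarrier (r : ℝ) :
    HasDerivAt (upperBarrier h M) (3 * h * r ^ 2 + 5 * M * r ^ 4) r := by
  refine (((hasDerivAt_pow 3 r).const_mul h).add ((hasDerivAt_pow 5 r).const_mul M)).congr_deriv ?_
  norm_num
  ring

/-- Positive pressure makes the derivative 1 - 2Ψ_{,R} exceed 1. This gives uniqueness of the
horizon on all of (0, r], not just between the barriers. -/
theorem ShellBounds.strictMonoOn_sub_mass {r : ℝ} (B : ShellBounds α h C Ψ Y₀ r) :
    StrictMonoOn (fun R => R - 2 * Ψ r R) (Ioc 0 r) := by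
  have hd : ∀ R ∈ Ioc 0 r, HasDerivAt (fun R => R - 2 * Ψ r R) (1 - 2 * massDR Ψ r R) R := by
    intro R hR
    have hdiff := (B.analytic R ⟨hR.1.le, hR.2⟩).differentiableAt
    rw [massDR_eq_fderiv hdiff]
    exact (hasDerivAt_id R).sub ((hasDerivAt_massDR hdiff).const_mul 2)
  refine strictMonoOn_of_deriv_pos (convex_Ioc 0 r)
    (fun R hR => (hd R hR).continuousAt.continuousWithinAt) fun R hR => ?_
  have hR' := interior_subset hR
  rw [(hd R hR').deriv]
  linarith [B.massDR_neg R hR']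

theorem BarrierBounds.exists_horizon {r : ℝ} (hM : 0 < M) (B : ShellBounds α h C Ψ Y₀ r)
    (E : BarrierBounds α h M K Ψ Y₀ r) :
    ∃ H ∈ Ioo (lowerBarrier h M r) (upperBarrier h M r), ∀ R ∈ Ioc 0 r,
      (R = 2 * Ψ r R ↔ R = H) ∧ (2 * Ψ r R < R ↔ H < R) := by
  have hmono := B.strictMonoOn_sub_mass
  have hLS := lowerBarrier_lt_upperBarrier (h := h) hM B.pos
  have hc : ContinuousOn (fun R => R - 2 * Ψ r R)
      (Icc (lowerBarrier h M r) (upperBarrier h M r)) := fun R hR =>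
    (continuousAt_id.sub (continuousAt_const.mul (hasDerivAt_massDR
      (B.analytic R ⟨E.lower_pos.le.trans hR.1, hR.2.trans E.upper_lt.le⟩).differentiableAt
        ).continuousAt)).continuousWithinAt
  obtain ⟨H, hH, hH0⟩ := intermediate_value_Ioo hLS.le hc
    (show (0 : ℝ) ∈ Ioo _ _ from ⟨by linarith [E.lower_lt_mass], by linarith [E.mass_lt_upper]⟩)
  have hH0 : H - 2 * Ψ r H = 0 := hH0
  have hHm : H ∈ Ioc 0 r := ⟨E.lower_pos.trans hH.1, (hH.2.trans E.upper_lt).le⟩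
  refine ⟨H, hH, fun R hR => ⟨?_, ?_⟩⟩
  · rw [← hmono.injOn.eq_iff hR hHm, hH0, sub_eq_zero]
  · rw [← hmono.lt_iff_lt hHm hR, hH0, sub_pos]

/-! ### Comoving time left before the singularity -/

theorem tendsto_integral_timeDensity (hα : 0 < α) (hα1 : α < 1) {Rg : ℝ → ℝ}
    (hB : ∀ᶠ r in 𝓝[>] (0 : ℝ), ShellBounds α h C Ψ Y₀ r)
    (hE : ∀ᶠ r in 𝓝[>] (0 : ℝ), BarrierBounds α h M K Ψ Y₀ r)
    (hi : ∀ᶠ r in 𝓝[>] (0 : ℝ),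
      IntervalIntegrable (timeDensity α Ψ Y₀ r) MeasureTheory.volume 0 r)
    (hpos : ∀ᶠ r in 𝓝[>] (0 : ℝ), 0 < Rg r ∧ Rg r ≤ upperBarrier h M r)
    (hRg : Tendsto Rg (𝓝[>] 0) (𝓝 0)) :
    Tendsto (fun r => ∫ σ in (0 : ℝ)..Rg r, timeDensity α Ψ Y₀ r σ) (𝓝[>] 0) (𝓝 0) := by
  have hβ : 0 < 1 - 2 * (α / (α + 1)) := by
    have : α / (α + 1) < 1 / 2 := by
      rw [div_lt_div_iff₀ (by positivity) (by norm_num)]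
      linarith
    linarith
  set p := -(2 * (α / (α + 1))) with hp
  have hp1 : 0 < p + 1 := by linarith
  have hlim : Tendsto (fun r => K * (Rg r ^ (p + 1) / (p + 1))) (𝓝[>] 0) (𝓝 0) := by
    have h1 := (Real.continuousAt_rpow_const 0 (p + 1) (Or.inr hp1.le)).tendsto.comp hRg
    rw [Real.zero_rpow hp1.ne'] at h1
    simpa using (h1.div_const (p + 1)).const_mul K
  have hev : ∀ᶠ r in 𝓝[>] (0 : ℝ), 0 ≤ (∫ σ in (0 : ℝ)..Rg r, timeDensity α Ψ Y₀ r σ) ∧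
      (∫ σ in (0 : ℝ)..Rg r, timeDensity α Ψ Y₀ r σ) ≤ K * (Rg r ^ (p + 1) / (p + 1)) := by
    filter_upwards [hB, hE, hi, hpos] with r B E hint hR
    have hsub : IntervalIntegrable (timeDensity α Ψ Y₀ r) MeasureTheory.volume 0 (Rg r) :=
      hint.mono_set (by
        rw [uIcc_of_le hR.1.le, uIcc_of_le B.pos.le]
        exact Icc_subset_Icc_right (hR.2.trans E.upper_lt.le))
    have hK : IntervalIntegrable (fun σ : ℝ => K * σ ^ p) MeasureTheory.volume 0 (Rg r) :=
      (intervalIntegral.intervalIntegrable_rpow' (by linarith)).const_mul K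
    constructor
    · have h0 := intervalIntegral.integral_mono_on_of_le_Ioo (f := fun _ => (0 : ℝ)) hR.1.le
        (by simp) hsub fun σ hσ => by
          have hσr : σ ∈ Ioc 0 r := ⟨hσ.1, hσ.2.le.trans (hR.2.trans E.upper_lt.le)⟩
          have := B.rarity_pos hσr
          rw [timeDensity, B.density_rpow_eq hα hσr]
          exact div_nonneg (by positivity) (Real.sqrt_nonneg _)
      simpa using h0
    · refine (intervalIntegral.integral_mono_on_of_le_Ioo hR.1.le hsub hK fun σ hσ =>
        E.timeDensity_le σ ⟨hσ.1, hσ.2.le.trans hR.2⟩).trans ?_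
      rw [intervalIntegral.integral_const_mul, integral_rpow (Or.inl (by linarith)),
        Real.zero_rpow hp1.ne', sub_zero]
  exact squeeze_zero' (hev.mono fun _ hr => hr.1) (hev.mono fun _ hr => hr.2) hlim

end PerfectFluid

/-! ### Assembly: the geodesics and their limit -/

open PerfectFluid in
theorem mainTheorem1 (α h t₀ : ℝ) (Ψ : ℝ → ℝ → ℝ) (Y₀ : ℝ → ℝ)
    (hα₀ : 0 < α) (hα₁ : α < 1) (hh : 0 < h)
    (hreg : PerfectFluid.IsRegularCollapse α Ψ Y₀)
    (hsing : PerfectFluid.CentralSingularityAt α Ψ Y₀ t₀)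
    (htaylor : PerfectFluid.HasMassExpansion α h Ψ) :
    ∃ b > 0, ∃ Rh : ℝ → ℝ, PerfectFluid.IsApparentHorizon Ψ b Rh ∧
      ∃ R₁ > Rh b, ∀ R₀ ∈ Set.Ioo (Rh b) R₁, ∃ Rg : ℝ → ℝ, Rg b = R₀ ∧
        PerfectFluid.EmanatesFromCentralSingularity α Ψ Y₀ t₀ b Rh Rg := by
  obtain ⟨C, hC, hB⟩ := exists_shellBounds hh hreg htaylor
  obtain ⟨M, hM, K, hK, hE⟩ := exists_barrierBounds hα₀ hα₁ hh hC hB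
  obtain ⟨b, hb, hBE⟩ := mem_nhdsGT_iff_exists_Ioc_subset.mp (hB.and hE)
  have hb : 0 < b := hb
  have B : ∀ r ∈ Ioc 0 b, ShellBounds α h C Ψ Y₀ r := fun r hr => (hBE hr).1
  have E : ∀ r ∈ Ioc 0 b, BarrierBounds α h M K Ψ Y₀ r := fun r hr => (hBE hr).2
  have hex : ∀ r, ∃ H, r ∈ Ioc 0 b → H ∈ Ioo (lowerBarrier h M r) (upperBarrier h M r) ∧
      ∀ R ∈ Ioc 0 r, (R = 2 * Ψ r R ↔ R = H) ∧ (2 * Ψ r R < R ↔ H < R) := by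
    intro r
    by_cases hr : r ∈ Ioc 0 b
    · obtain ⟨H, h1, h2⟩ := (E r hr).exists_horizon hM (B r hr)
      exact ⟨H, fun _ => ⟨h1, h2⟩⟩
    · exact ⟨0, fun h => absurd h hr⟩
  choose Rh hRh using hex
  have hbb : b ∈ Ioc 0 b := ⟨hb, le_rfl⟩
  refine ⟨b, hb, Rh, fun r hr => ⟨⟨(E r hr).lower_pos.trans (hRh r hr).1.1,
    (hRh r hr).1.2.trans (E r hr).upper_lt⟩, fun R hR => ((hRh r hr).2 R hR).1⟩,
    upperBarrier h M b, (hRh b hbb).1.2, fun R₀ hR₀ => ?_⟩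
  obtain ⟨Rg, hRgb, hRg⟩ := exists_hasDerivWithinAt_Ioc_of_lipschitz hb
    (fun a ha => clampedSlope_lipschitz hα₀ hh hM B E ha) R₀
  have hRgc : ContinuousOn Rg (Ioc 0 b) := fun r hr => (hRg r hr).continuousWithinAt
  have hRgd : ∀ r ∈ Ioo 0 b, HasDerivAt Rg (clampedSlope α h M Ψ Y₀ r (Rg r)) r := fun r hr =>
    (hRg r (Ioo_subset_Ioc_self hr)).hasDerivAt (Ioc_mem_nhds hr.1 hr.2)
  have hupper : ∀ r ∈ Ioc 0 b, 0 < upperBarrier h M r - Rg r := by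
    refine pos_of_deriv_neg_at_zeros (continuous_upperBarrier.continuousOn.sub hRgc)
      (by rw [hRgb]; linarith [hR₀.2]) fun r hr h0 => ⟨_, ?_,
        (hasDerivAt_upperBarrier r).sub (hRgd r hr)⟩
    have hr' := Ioo_subset_Ioc_self hr
    rw [← sub_eq_zero.mp h0, clampedSlope_eq (lowerBarrier_lt_upperBarrier hM hr.1).le le_rfl]
    linarith [(E r hr').upper_slope]
  -- The lower barrier lies behind the horizon, where the slope is nonpositive, while the barrier
  -- increases. With `hupper` this shows the clamp is never active, so the solution is a true
  -- geodesic.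
  have hlower : ∀ r ∈ Ioc 0 b, 0 < Rg r - lowerBarrier h M r := by
    refine pos_of_deriv_neg_at_zeros (hRgc.sub continuous_lowerBarrier.continuousOn)
      (by rw [hRgb]; linarith [hR₀.1, (hRh b hbb).1.1]) fun r hr h0 => ⟨_, ?_,
        (hRgd r hr).sub (hasDerivAt_lowerBarrier r)⟩
    have hr' := Ioo_subset_Ioc_self hr
    have hLS := lowerBarrier_lt_upperBarrier (h := h) hM hr.1
    rw [sub_eq_zero.mp h0, clampedSlope_eq le_rfl hLS.le]
    have := nullSlope_nonpos hα₀ hh (B r hr') ⟨(E r hr').lower_pos, (hLS.trans (E r hr').upper_lt).le⟩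
      (E r hr').lower_lt_mass.le
    linarith [(E r hr').lower_slope]
  have hmem : ∀ r ∈ Ioc 0 b, Rg r ∈ Ioc 0 r := fun r hr =>
    ⟨by linarith [hlower r hr, (E r hr).lower_pos], by linarith [hupper r hr, (E r hr).upper_lt]⟩
  have hslope : ∀ r ∈ Ioc 0 b,
      clampedSlope α h M Ψ Y₀ r (Rg r) = nullSlope α Ψ Y₀ r (Rg r) := fun r hr =>
    clampedSlope_eq (by linarith [hlower r hr]) (by linarith [hupper r hr])
  have hana : ∀ r ∈ Ioc 0 b, AnalyticAt ℝ (Function.uncurry Ψ) (r, Rg r) := fun r hr =>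
    (B r hr).analytic _ ⟨(hmem r hr).1.le, (hmem r hr).2⟩
  -- At a zero the geodesic has slope 0, so only the explicit r-dependence of Ψ contributes: the
  -- derivative is -2Ψ_{,r}.
  have hhor : ∀ r ∈ Ioc 0 b, 0 < Rg r - 2 * Ψ r (Rg r) := by
    refine pos_of_deriv_neg_at_zeros (hRgc.sub (continuousOn_const.mul fun r hr =>
      ContinuousAt.comp_continuousWithinAt (f := fun r => (r, Rg r)) (hana r hr).continuousAt
        (continuousWithinAt_id.prodMk (hRgc r hr)))) ?_ fun r hr h0 => ?_
    · rw [sub_pos]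
      exact ((hRh b hbb).2 _ (hmem b hbb)).2.mpr (by rw [hRgb]; exact hR₀.1)
    · have hr' := Ioo_subset_Ioc_self hr
      have hd := hRgd r hr
      rw [hslope r hr', nullSlope_eq_zero hα₀ hh (B r hr') (hmem r hr') (sub_eq_zero.mp h0)] at hd
      have hdiff := (hana r hr').differentiableAt
      have hΨ : HasDerivAt (fun s => Ψ s (Rg s)) (massDr Ψ r (Rg r)) r := by
        rw [massDr_eq_fderiv hdiff]
        exact HasFDerivAt.comp_hasDerivAt (f := fun s => (s, Rg s)) r hdiff.hasFDerivAt
          ((hasDerivAt_id r).prodMk hd)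
      refine ⟨_, ?_, hd.sub (hΨ.const_mul 2)⟩
      have h1 := (B r hr').le_massDr _ ⟨(hmem r hr').1.le, (hmem r hr').2⟩
      have h2 := mul_pos hh (pow_pos hr.1 2)
      linarith
  have hIoc : ∀ᶠ r in 𝓝[>] (0 : ℝ), r ∈ Ioc 0 b := Ioc_mem_nhdsGT hb
  have hRg0 : Tendsto Rg (𝓝[>] 0) (𝓝 0) :=
    squeeze_zero' (hIoc.mono fun r hr => (hmem r hr).1.le) (hIoc.mono fun r hr => (hmem r hr).2)
      (tendsto_id.mono_left nhdsWithin_le_nhds)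
  refine ⟨Rg, hRgb, fun r hr => ⟨((hRh r hr).2 _ (hmem r hr)).2.mp (sub_pos.mp (hhor r hr)),
    by linarith [hupper r hr, (E r hr).upper_lt]⟩, fun r hr => ?_, hRg0, ?_⟩
  · rw [← hslope r hr]
    exact hRg r hr
  · have hint := tendsto_integral_timeDensity hα₀ hα₁ hB hE hsing.finite
      (hIoc.mono fun r hr => ⟨(hmem r hr).1, by linarith [hupper r hr]⟩) hRg0
    have hlim := hsing.tendsto.sub hint
    rw [sub_zero] at hlim
    refine hlim.congr' ?_
    filter_upwards [hIoc, hsing.finite] with r hr hi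
    have hm := hmem r hr
    rw [singularityTime, comovingTime, comovingTime, sub_eq_iff_eq_add, add_comm]
    refine (intervalIntegral.integral_add_adjacent_intervals (hi.mono_set ?_)
      (hi.mono_set ?_)).symm
    · rw [uIcc_of_le hm.1.le, uIcc_of_le hr.1.le]
      exact Icc_subset_Icc_right hm.2
    · rw [uIcc_of_le hm.2, uIcc_of_le hr.1.le]
      exact Icc_subset_Icc_left hm.1.le
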